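/- Let $\mathcal X,\mathcal Y,\mathcal Z,\mathcal E,\mathcal U$ be finite alphabets, let $(X,Y,Z,E)$ have an arbitrary joint distribution on $\mathcal X\times\mathcal Y\times\mathcal Z\times\mathcal E$, and let $(X^n,Y^n,Z^n,E^n)$ be $n$ i.i.d. copies of it. Entropies and mutual informations are in bits. A $(2^{nR_A},n)$ code consists of an encoder $f_A:\mathcal Y^n\to\{1,\dots,\lfloor 2^{nR_A}\rfloor\}$ (Alice sees $Y^n$ but not $X^n$) and a decoder $f_B:\{1,\dots,\lfloor 2^{nR_A}\rfloor\}\times\mathcal Z^n\to\mathcal Y^n$ (Bob sees the message and the uncoded side information $Z^n$); write $J=f_A(Y^n)$. Eve observes $J$ and $E^n$. A pair $(R_A,\Delta)\in\mathbb R_+^2$ is achievable if for every $\varepsilon>0$ and all sufficiently large $n$ there is a $(2^{nR_A},n)$ code with $$\Pr\big(f_B(J,Z^n)\neq Y^n\big)<\varepsilon\qquad\text{and}\qquad \tfrac1n H(X^n\mid E^n,J)\ \ge\ \Delta-\varepsilon .$$ Theorem. Let $U$ be any $\mathcal U$-valued random variable, jointly distributed with $(X,Y,Z,E)$, such that $(X,Z,E)-Y-U$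 is a Markov chain. Let $(R_A,\Delta)\in\mathbb R_+^2$ satisfy $$R_A\ \ge\ H(Y|Z),\qquad \Delta\ \le\ I(Y;Z|U)-I(Y;E|U)+H(X|E,U)-H(Y|E,U).$$ Then $(R_A,\Delta)$ belongs to the closure of the set of achievable pairs, and if $R_A>H(Y|Z)$, then $(R_A,\Delta)$ is itself achievable. -/

import Mathlib

open Filter Topology

namespace SecureCoding

/-! Finite probability spaces: `p : Ω → ℝ` is the probability mass function on a finite set `Ω`;
random variables are functions on `Ω` with values in finite alphabets. -/

open Classical in
/-- The probability of the event `S` under the probability mass function `p`. -/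
noncomputable def prob {Ω : Type*} [Fintype Ω] (p : Ω → ℝ) (S : Ω → Prop) : ℝ :=
  ∑ ω, if S ω then p ω else 0

/-- The conditional Shannon entropy in bits,
`H(A|B) = - ∑ P(A = a, B = b) log₂ P(A = a | B = b)`, where terms with `P(A = a, B = b) = 0`
are zero. -/
noncomputable def condEntropy {Ω α β : Type*} [Fintype Ω] [Fintype α] [Fintype β]
    (p : Ω → ℝ) (A : Ω → α) (B : Ω → β) : ℝ :=
  -∑ a, ∑ b, prob p (fun ω => A ω = a ∧ B ω = b) *
    Real.logb 2 (prob p (fun ω => A ω = a ∧ B ω = b) / prob p (fun ω => B ω = b))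

/-- The conditional mutual information in bits, `I(A;B|C) = H(A|C) - H(A|B,C)`. -/
noncomputable def condMutualInfo {Ω α β γ : Type*} [Fintype Ω] [Fintype α] [Fintype β] [Fintype γ]
    (p : Ω → ℝ) (A : Ω → α) (B : Ω → β) (C : Ω → γ) : ℝ :=
  condEntropy p A C - condEntropy p A (fun ω => (B ω, C ω))

/-- `A – B – C` is a Markov chain: `P(a,b,c) P(b) = P(a,b) P(b,c)` for all `a`, `b`, `c`. -/
def IsMarkovChain {Ω α β γ : Type*} [Fintype Ω]
    (p : Ω → ℝ) (A : Ω → α) (B : Ω → β) (C : Ω → γ) : Prop :=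
  ∀ a b c,
    prob p (fun ω => A ω = a ∧ B ω = b ∧ C ω = c) * prob p (fun ω => B ω = b) =
      prob p (fun ω => A ω = a ∧ B ω = b) * prob p (fun ω => B ω = b ∧ C ω = c)

/-- The law on `Ωⁿ` of `n` independent draws from `p`. -/
noncomputable def iidLaw {Ω : Type*} (p : Ω → ℝ) (n : ℕ) : (Fin n → Ω) → ℝ :=
  fun ω => ∏ i, p (ω i)

/-- The block `Aⁿ = (A₁, …, Aₙ)` of `n` copies of `A`, as a random variable on `Ωⁿ`. -/
def block {Ω α : Type*} (A : Ω → α) (n : ℕ) : (Fin n → Ω) → (Fin n → α) :=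
  fun ω i => A (ω i)

/-- A code of block length `n` with `M` messages: Alice's (deterministic) encoder sees only `yⁿ`;
Bob's decoder sees the message and the uncoded side information `zⁿ`. -/
structure Code (𝒴 𝒵 : Type*) (n M : ℕ) where
  /-- Alice's encoder `f_A : 𝒴ⁿ → {1, …, M}`. -/
  enc : (Fin n → 𝒴) → Fin M
  /-- Bob's decoder `f_B : {1, …, M} × 𝒵ⁿ → 𝒴ⁿ`. -/
  dec : Fin M → (Fin n → 𝒵) → (Fin n → 𝒴)

/-- The message `J = f_A(Yⁿ)`, as a random variable on `Ωⁿ`. -/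
def Code.message {Ω 𝒴 𝒵 : Type*} {n M : ℕ} (c : Code 𝒴 𝒵 n M) (Y : Ω → 𝒴) :
    (Fin n → Ω) → Fin M :=
  fun ω => c.enc (block Y n ω)

/-- The probability `Pr(f_B(J, Zⁿ) ≠ Yⁿ)` that Bob's reconstruction is wrong. -/
noncomputable def Code.errorProb {Ω 𝒴 𝒵 : Type*} [Fintype Ω] {n M : ℕ} (c : Code 𝒴 𝒵 n M)
    (p : Ω → ℝ) (Y : Ω → 𝒴) (Z : Ω → 𝒵) : ℝ :=
  prob (iidLaw p n) (fun ω => c.dec (c.message Y ω) (block Z n ω) ≠ block Y n ω)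

/-- Eve's normalized equivocation `(1/n) H(Xⁿ | Eⁿ, J)`. -/
noncomputable def Code.equivocation {Ω 𝒳 𝒴 𝒵 ℰ : Type*} [Fintype Ω] [Fintype 𝒳] [Fintype ℰ]
    {n M : ℕ} (c : Code 𝒴 𝒵 n M) (p : Ω → ℝ) (X : Ω → 𝒳) (Y : Ω → 𝒴) (E : Ω → ℰ) : ℝ :=
  1 / (n : ℝ) * condEntropy (iidLaw p n) (block X n) (fun ω => (block E n ω, c.message Y ω))

/-- The rate-equivocation pair `(R, Δ) ∈ ℝ₊²` is achievable: for every `ε > 0` and all large `n`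
there is a `(2^{nR}, n)` code with error probability `< ε` and equivocation `≥ Δ - ε`. -/
def Achievable {Ω 𝒳 𝒴 𝒵 ℰ : Type*} [Fintype Ω] [Fintype 𝒳] [Fintype ℰ]
    (p : Ω → ℝ) (X : Ω → 𝒳) (Y : Ω → 𝒴) (Z : Ω → 𝒵) (E : Ω → ℰ) (R Δ : ℝ) : Prop :=
  0 ≤ R ∧ 0 ≤ Δ ∧ ∀ ε : ℝ, 0 < ε → ∀ᶠ n : ℕ in atTop,
    ∃ c : Code 𝒴 𝒵 n ⌊(2 : ℝ) ^ ((n : ℝ) * R)⌋₊,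
      c.errorProb p Y Z < ε ∧ Δ - ε ≤ c.equivocation p X Y E

end SecureCoding

/-!
The bound on `Δ` simplifies to `H(X|E,U) - H(Y|Z,U)`. This pair of entropies suggests the
code: Alice quantizes `Yⁿ` to a codeword index `v(Yⁿ)` that plays the role of `Uⁿ`, and sends a
random bin number of the index together with a random bin number of `Yⁿ` itself.

* *Quantization* (`IsMarkovChain.exists_quantizer`, `IsMarkovChain.eventually_exists_quantizer`).
  About `2 ^ (n I(Y;U))` random codewords suffice for the codeword to replace `Uⁿ`: every event that
  is asymptotically rare for `(Xⁿ, Zⁿ, Eⁿ, Yⁿ, Uⁿ)` stays rare for the codeword. This includes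
  events that involve `Xⁿ`, `Zⁿ`, `Eⁿ`, which Alice does not see, because codewords are selected by
  the conditional probability of the event given `Yⁿ`.
* *Decoding* (`exists_binning`). Bob lists the candidates typical with `Zⁿ`. A wrong candidate with
  another codeword index has to collide in both bin numbers, one with the same index only in the
  second. So it suffices that the two numbers together have rate above `H(Y|Z)`, and the second one
  rate above `H(Y|Z,U)`; the first rate is whatever remains.
* *Equivocation* (`le_condEntropy_of_message`). Eve's uncertainty only drops if she is given the
  whole index in place of its bin number. The second bin number then costs at most its length,
  `n H(Y|Z,U)`, so it remains to see that `H(Xⁿ|Eⁿ, v(Yⁿ))` is about `n H(X|E,U)`. It equals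
  `H(Xⁿ,Eⁿ,Yⁿ) - H(v(Yⁿ)) - H(Yⁿ|Xⁿ,Eⁿ,v(Yⁿ)) - H(Eⁿ|v(Yⁿ))`, where the first term is explicit, the
  second is at most the length `n I(Y;U)` of the index, and the others are bounded from above by
  Gibbs' inequality.

Typicality is expressed throughout by the codelength `-∑ log₂ Q(aᵢ|bᵢ)` for a strictly positive
kernel `Q` close to the conditional law of `A` given `B` (`exists_pos_kernel`): the sequences of
short codelength are few (`card_codelength_le`), and since the codelength is bounded, its
expectation, and with it the conditional entropy, is controlled by its typical value
(`condEntropy_le_of_prob_codelength_le`). The only limit theorem needed is the weak law of large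
numbers (`tendsto_prob_lt_sum`).
-/

namespace SecureCoding

/-! ### Probabilities and expectations on finite spaces -/

open Classical in
lemma prob_eq_sum_mul {Ω : Type*} [Fintype Ω] (p : Ω → ℝ) (S : Ω → Prop) :
    prob p S = ∑ ω, p ω * (if S ω then 1 else 0) := by
  simp [prob]

section Prob

variable {Ω α β γ : Type*} [Fintype Ω] {p : Ω → ℝ}

lemma prob_nonneg (hp : ∀ ω, 0 ≤ p ω) (S : Ω → Prop) : 0 ≤ prob p S := by
  classical
  unfold prob
  exact Finset.sum_nonneg fun ω _ => by split_ifs <;> simp [hp]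

lemma prob_mono_of_pos (hp : ∀ ω, 0 ≤ p ω) {S T : Ω → Prop} (h : ∀ ω, 0 < p ω → S ω → T ω) :
    prob p S ≤ prob p T := by
  classical
  unfold prob
  refine Finset.sum_le_sum fun ω _ => ?_
  rcases (hp ω).eq_or_lt with h0 | h0
  · simp [← h0]
  by_cases hS : S ω
  · simp [hS, h ω h0 hS]
  · simp only [hS, if_false]
    split_ifs <;> simp [hp]

lemma prob_mono (hp : ∀ ω, 0 ≤ p ω) {S T : Ω → Prop} (h : ∀ ω, S ω → T ω) :
    prob p S ≤ prob p T :=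
  prob_mono_of_pos hp fun ω _ => h ω

lemma prob_congr {S T : Ω → Prop} (h : ∀ ω, S ω ↔ T ω) : prob p S = prob p T := by
  have : S = T := funext fun ω => propext (h ω)
  rw [this]

lemma prob_or_le (hp : ∀ ω, 0 ≤ p ω) (S T : Ω → Prop) :
    prob p (fun ω => S ω ∨ T ω) ≤ prob p S + prob p T := by
  classical
  unfold prob
  rw [← Finset.sum_add_distrib]
  refine Finset.sum_le_sum fun ω _ => ?_
  have := hp ω
  by_cases hS : S ω <;> by_cases hT : T ω <;> simp [hS, hT, this]

lemma prob_true : prob p (fun _ => True) = ∑ ω, p ω := by simp [prob]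

lemma prob_not (S : Ω → Prop) : prob p (fun ω => ¬ S ω) = ∑ ω, p ω - prob p S := by
  classical
  unfold prob
  rw [← Finset.sum_sub_distrib]
  refine Finset.sum_congr rfl fun ω _ => ?_
  by_cases hS : S ω <;> simp [hS]

lemma le_prob (hp : ∀ ω, 0 ≤ p ω) {S : Ω → Prop} {ω : Ω} (h : S ω) : p ω ≤ prob p S := by
  classical
  unfold prob
  have := Finset.single_le_sum (f := fun ω => if S ω then p ω else 0)
    (fun ω _ => by split_ifs <;> simp [hp]) (Finset.mem_univ ω)
  simpa [h] using this

lemma prob_pos (hp : ∀ ω, 0 ≤ p ω) {S : Ω → Prop} {ω : Ω} (hω : 0 < p ω) (h : S ω) :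
    0 < prob p S := hω.trans_le (le_prob hp h)

open Classical in
/-- The expectation of a function of `A` computed from the law of `A`, restricted to an event. -/
lemma sum_prob_and_mul [Fintype α] (A : Ω → α) (S : Ω → Prop) (f : α → ℝ) :
    ∑ a, prob p (fun ω => A ω = a ∧ S ω) * f a = ∑ ω, p ω * ((if S ω then 1 else 0) * f (A ω)) := by
  simp_rw [prob_eq_sum_mul, Finset.sum_mul]
  rw [Finset.sum_comm]
  refine Finset.sum_congr rfl fun ω _ => ?_
  rw [Finset.sum_eq_single (A ω)]
  · by_cases hS : S ω <;> simp [hS]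
  · intro b _ hb
    simp [Ne.symm hb]
  · simp

lemma sum_prob_mul [Fintype α] (A : Ω → α) (f : α → ℝ) :
    ∑ a, prob p (fun ω => A ω = a) * f a = ∑ ω, p ω * f (A ω) := by
  have := sum_prob_and_mul (p := p) A (fun _ => True) f
  simpa using this

lemma sum_prob [Fintype α] (A : Ω → α) : ∑ a, prob p (fun ω => A ω = a) = ∑ ω, p ω := by
  simpa using sum_prob_mul (p := p) A (fun _ => 1)

lemma sum_prob_and [Fintype α] (A : Ω → α) (S : Ω → Prop) :
    ∑ a, prob p (fun ω => A ω = a ∧ S ω) = prob p S := by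
  classical
  have := sum_prob_and_mul (p := p) A S (fun _ => 1)
  simpa [prob] using this

/-- The law of a function of `A` is a marginal of the law of `A`. -/
lemma prob_comp_and [Fintype α] [DecidableEq β] (A : Ω → α) (f : α → β) (b : β) (S : Ω → Prop) :
    prob p (fun ω => f (A ω) = b ∧ S ω) =
      ∑ a, prob p (fun ω => A ω = a ∧ S ω) * (if f a = b then 1 else 0) := by
  classical
  rw [sum_prob_and_mul, prob_eq_sum_mul]
  refine Finset.sum_congr rfl fun ω _ => ?_
  by_cases hS : S ω <;> by_cases hf : f (A ω) = b <;> simp [hS, hf]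

/-- Markov's inequality. -/
lemma mul_prob_lt_le (hp : ∀ ω, 0 ≤ p ω) {f : Ω → ℝ} (hf : ∀ ω, 0 ≤ f ω) (s : ℝ) :
    s * prob p (fun ω => s < f ω) ≤ ∑ ω, p ω * f ω := by
  classical
  rw [prob_eq_sum_mul, Finset.mul_sum]
  refine Finset.sum_le_sum fun ω _ => ?_
  by_cases h : s < f ω
  · simp only [h, if_true, mul_one]
    rw [mul_comm]
    exact mul_le_mul_of_nonneg_left h.le (hp ω)
  · simp only [h, if_false, mul_zero]
    exact mul_nonneg (hp ω) (hf ω)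

lemma sum_mul_le_of_prob_lt_le (hp : ∀ ω, 0 ≤ p ω) (hp1 : ∑ ω, p ω = 1) {f : Ω → ℝ} {a K θ : ℝ}
    (ha : 0 ≤ a) (hK : 0 ≤ K) (hfK : ∀ ω, f ω ≤ K) (h : prob p (fun ω => a < f ω) ≤ θ) :
    ∑ ω, p ω * f ω ≤ a + K * θ := by
  classical
  calc ∑ ω, p ω * f ω ≤ ∑ ω, (p ω * a + K * (p ω * (if a < f ω then 1 else 0))) := by
        refine Finset.sum_le_sum fun ω _ => ?_
        by_cases h : a < f ω
        · simp only [h, if_true, mul_one]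
          nlinarith [mul_le_mul_of_nonneg_left (hfK ω) (hp ω), mul_nonneg (hp ω) ha]
        · simp only [h, if_false, mul_zero, add_zero]
          exact mul_le_mul_of_nonneg_left (not_lt.1 h) (hp ω)
    _ = a + K * prob p (fun ω => a < f ω) := by
        rw [Finset.sum_add_distrib, ← Finset.sum_mul, hp1, ← Finset.mul_sum, prob_eq_sum_mul]
        ring
    _ ≤ a + K * θ := by gcongr

/-- A weighted average is attained from below by some point. -/
lemma exists_le_of_sum_mul_le (hp : ∀ ω, 0 ≤ p ω) (hp1 : ∑ ω, p ω = 1) {f : Ω → ℝ} {K : ℝ}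
    (h : ∑ ω, p ω * f ω ≤ K) : ∃ ω, f ω ≤ K := by
  by_contra! hc
  obtain ⟨ω₀, -, hω₀⟩ : ∃ ω ∈ Finset.univ, 0 < p ω := by
    by_contra! h0
    have : ∑ ω, p ω ≤ 0 := Finset.sum_nonpos h0
    linarith
  have : ∑ ω, p ω * K < ∑ ω, p ω * f ω :=
    Finset.sum_lt_sum (fun ω _ => mul_le_mul_of_nonneg_left (hc ω).le (hp ω))
      ⟨ω₀, Finset.mem_univ _, mul_lt_mul_of_pos_left (hc ω₀) hω₀⟩
  rw [← Finset.sum_mul, hp1, one_mul] at this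
  linarith

end Prob

/-! ### Entropy calculus -/

section Entropy

variable {Ω α β γ δ : Type*} [Fintype Ω] {p : Ω → ℝ}

/-- The Shannon entropy in bits `H(A) = - E[log₂ P(A)]`, as an expectation over the underlying
probability space. -/
noncomputable def entropy (p : Ω → ℝ) (A : Ω → α) : ℝ :=
  -∑ ω, p ω * Real.logb 2 (prob p (fun ω' => A ω' = A ω))

lemma condEntropy_eq_sum [Fintype α] [Fintype β] (A : Ω → α) (B : Ω → β) :
    condEntropy p A B = -∑ ω, p ω * Real.logb 2
      (prob p (fun ω' => A ω' = A ω ∧ B ω' = B ω) / prob p (fun ω' => B ω' = B ω)) := by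
  unfold condEntropy
  congr 1
  rw [← Fintype.sum_prod_type' (f := fun a b => prob p (fun ω => A ω = a ∧ B ω = b) *
    Real.logb 2 (prob p (fun ω => A ω = a ∧ B ω = b) / prob p (fun ω => B ω = b)))]
  rw [← sum_prob_mul (p := p) (fun ω => (A ω, B ω)) (fun x => Real.logb 2
      (prob p (fun ω' => A ω' = x.1 ∧ B ω' = x.2) / prob p (fun ω' => B ω' = x.2)))]
  refine Finset.sum_congr rfl fun x _ => ?_
  rw [prob_congr (S := fun ω => (A ω, B ω) = x) (T := fun ω => A ω = x.1 ∧ B ω = x.2)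
    (fun ω => by rw [Prod.ext_iff])]

lemma condEntropy_eq_entropy_sub [Fintype α] [Fintype β] (hp : ∀ ω, 0 ≤ p ω)
    (A : Ω → α) (B : Ω → β) :
    condEntropy p A B = entropy p (fun ω => (A ω, B ω)) - entropy p B := by
  rw [condEntropy_eq_sum, entropy, entropy, sub_neg_eq_add, ← sub_eq_neg_add, ← neg_sub,
    ← Finset.sum_sub_distrib]
  congr 1
  refine Finset.sum_congr rfl fun ω _ => ?_
  rcases (hp ω).eq_or_lt with h | h
  · simp [← h]
  · have h1 : 0 < prob p (fun ω' => A ω' = A ω ∧ B ω' = B ω) := prob_pos hp h ⟨rfl, rfl⟩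
    have h2 : 0 < prob p (fun ω' => B ω' = B ω) := prob_pos hp h rfl
    rw [Real.logb_div h1.ne' h2.ne', mul_sub]
    simp only [Prod.mk.injEq]

/-- Entropy depends only on the partition of the sample space induced by the variable. -/
lemma entropy_congr {A : Ω → α} {B : Ω → β} (h : ∀ ω ω', A ω' = A ω ↔ B ω' = B ω) :
    entropy p A = entropy p B := by
  unfold entropy
  congr 1
  refine Finset.sum_congr rfl fun ω _ => ?_
  rw [prob_congr (h ω)]

lemma entropy_mono (hp : ∀ ω, 0 ≤ p ω) {A : Ω → α} {B : Ω → β}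
    (h : ∀ ω ω', A ω' = A ω → B ω' = B ω) : entropy p B ≤ entropy p A := by
  unfold entropy
  refine neg_le_neg (Finset.sum_le_sum fun ω _ => ?_)
  rcases (hp ω).eq_or_lt with h0 | h0
  · simp [← h0]
  · exact mul_le_mul_of_nonneg_left (Real.logb_le_logb_of_le one_lt_two (prob_pos hp h0 rfl)
      (prob_mono hp (h ω))) (hp ω)

lemma condEntropy_nonneg [Fintype α] [Fintype β] (hp : ∀ ω, 0 ≤ p ω) (A : Ω → α) (B : Ω → β) :
    0 ≤ condEntropy p A B := by
  rw [condEntropy_eq_entropy_sub hp, sub_nonneg]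
  exact entropy_mono hp fun ω ω' h => (Prod.ext_iff.1 h).2

/-- Gibbs' inequality: coding `A` given `B` with the conditional sub-probability `Q` costs at
least `H(A|B)` bits. -/
lemma condEntropy_le_sum_neg_logb [Fintype α] [Fintype β] (hp : ∀ ω, 0 ≤ p ω)
    (hp1 : ∑ ω, p ω = 1) (A : Ω → α) (B : Ω → β) (Q : α → β → ℝ) (hQ0 : ∀ a b, 0 ≤ Q a b)
    (hQ : ∀ ω, 0 < p ω → 0 < Q (A ω) (B ω)) (hQ1 : ∀ b, ∑ a, Q a b ≤ 1) :
    condEntropy p A B ≤ ∑ ω, p ω * -Real.logb 2 (Q (A ω) (B ω)) := by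
  have hlog2 : 0 < Real.log 2 := Real.log_pos one_lt_two
  set r : α → β → ℝ := fun a b => Q a b * prob p (fun ω' => B ω' = b) /
    prob p (fun ω' => A ω' = a ∧ B ω' = b) with hr
  have hsum : ∑ ω, p ω * r (A ω) (B ω) ≤ 1 := by
    rw [← sum_prob_mul (p := p) (fun ω => (A ω, B ω)) (fun x => r x.1 x.2), Fintype.sum_prod_type,
      Finset.sum_comm]
    calc _ ≤ ∑ b, ∑ a, Q a b * prob p (fun ω' => B ω' = b) := by
          refine Finset.sum_le_sum fun b _ => Finset.sum_le_sum fun a _ => ?_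
          rw [prob_congr (S := fun ω => (A ω, B ω) = (a, b)) (T := fun ω => A ω = a ∧ B ω = b)
            (fun ω => by rw [Prod.ext_iff])]
          simp only [hr]
          rcases (prob_nonneg hp (fun ω => A ω = a ∧ B ω = b)).eq_or_lt with h | h
          · rw [← h, zero_mul]
            exact mul_nonneg (hQ0 _ _) (prob_nonneg hp _)
          · rw [mul_div_cancel₀ _ h.ne']
      _ ≤ ∑ b, 1 * prob p (fun ω' => B ω' = b) := by
          refine Finset.sum_le_sum fun b _ => ?_
          rw [← Finset.sum_mul]
          exact mul_le_mul_of_nonneg_right (hQ1 b) (prob_nonneg hp _)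
      _ = 1 := by simp only [one_mul, sum_prob, hp1]
  rw [condEntropy_eq_sum, ← Finset.sum_neg_distrib, ← sub_nonpos, ← Finset.sum_sub_distrib]
  calc _ ≤ ∑ ω, (p ω * r (A ω) (B ω) - p ω) / Real.log 2 := by
        refine Finset.sum_le_sum fun ω _ => ?_
        rcases (hp ω).eq_or_lt with h | h
        · simp [← h]
        have h1 : 0 < prob p (fun ω' => A ω' = A ω ∧ B ω' = B ω) := prob_pos hp h ⟨rfl, rfl⟩
        have h2 : 0 < prob p (fun ω' => B ω' = B ω) := prob_pos hp h rfl
        have h3 := hQ ω h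
        have h4 : 0 < r (A ω) (B ω) := by positivity
        have h5 := Real.log_le_sub_one_of_pos h4
        have h6 : Real.log (r (A ω) (B ω)) = Real.log (Q (A ω) (B ω)) +
            Real.log (prob p (fun ω' => B ω' = B ω)) -
            Real.log (prob p (fun ω' => A ω' = A ω ∧ B ω' = B ω)) := by
          simp only [hr]
          rw [Real.log_div (by positivity) h1.ne', Real.log_mul h3.ne' h2.ne']
        rw [Real.logb_div h1.ne' h2.ne', Real.logb, Real.logb, Real.logb, le_div_iff₀ hlog2]
        have : (-(p ω * (Real.log (prob p fun ω' => A ω' = A ω ∧ B ω' = B ω) / Real.log 2 -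
            Real.log (prob p fun ω' => B ω' = B ω) / Real.log 2)) -
            p ω * -(Real.log (Q (A ω) (B ω)) / Real.log 2)) * Real.log 2 =
            p ω * Real.log (r (A ω) (B ω)) := by
          rw [h6]; field_simp; ring
        rw [this]
        nlinarith
    _ ≤ 0 := by
        rw [← Finset.sum_div, Finset.sum_sub_distrib, hp1]
        exact div_nonpos_of_nonpos_of_nonneg (by linarith) hlog2.le

lemma sum_prob_div_le_one [Fintype α] (A : Ω → α) (B : Ω → β) (b : β) :
    ∑ a, prob p (fun ω => A ω = a ∧ B ω = b) / prob p (fun ω => B ω = b) ≤ 1 := by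
  rw [← Finset.sum_div, sum_prob_and]
  exact div_self_le_one _

/-- Conditioning on more reduces entropy. -/
lemma condEntropy_le_condEntropy_comp [Fintype α] [Fintype β] [Fintype γ] (hp : ∀ ω, 0 ≤ p ω)
    (hp1 : ∑ ω, p ω = 1) (A : Ω → α) (B : Ω → β) (f : β → γ) :
    condEntropy p A B ≤ condEntropy p A (fun ω => f (B ω)) := by
  refine (condEntropy_le_sum_neg_logb hp hp1 A B
    (fun a b => prob p (fun ω => A ω = a ∧ f (B ω) = f b) / prob p (fun ω => f (B ω) = f b))
    (fun a b => div_nonneg (prob_nonneg hp _) (prob_nonneg hp _)) (fun ω h => ?_)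
    (fun b => sum_prob_div_le_one A (fun ω => f (B ω)) (f b))).trans_eq ?_
  · exact div_pos (prob_pos hp h ⟨rfl, rfl⟩) (prob_pos hp h rfl)
  · rw [condEntropy_eq_sum, ← Finset.sum_neg_distrib]
    simp

lemma condEntropy_le_logb_card [Fintype α] [Fintype β] (hp : ∀ ω, 0 ≤ p ω)
    (hp1 : ∑ ω, p ω = 1) (A : Ω → α) (B : Ω → β) :
    condEntropy p A B ≤ Real.logb 2 (Fintype.card α) := by
  rcases isEmpty_or_nonempty α with h | h
  · simp [condEntropy]
  have hc : (0 : ℝ) < Fintype.card α := by exact_mod_cast Fintype.card_pos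
  refine (condEntropy_le_sum_neg_logb hp hp1 A B (fun _ _ => (Fintype.card α : ℝ)⁻¹)
    (fun a b => by positivity) (fun ω _ => by positivity) (fun b => ?_)).trans_eq ?_
  · simp [hc.ne']
  · rw [← Finset.sum_mul, hp1, Real.logb_inv]; ring

/-- The conditional law of `A` given `B` can be approximated, in the sense of relative entropy,
by a strictly positive conditional sub-probability, whose logarithm is then bounded. -/
lemma exists_pos_kernel [Fintype α] [Fintype β] [Nonempty α] (hp : ∀ ω, 0 ≤ p ω)
    (hp1 : ∑ ω, p ω = 1) (A : Ω → α) (B : Ω → β) {δ : ℝ} (hδ : 0 < δ) :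
    ∃ (Q : α → β → ℝ) (C : ℝ), 0 ≤ C ∧ (∀ a b, 0 < Q a b) ∧ (∀ b, ∑ a, Q a b ≤ 1) ∧
      (∀ a b, -Real.logb 2 (Q a b) ≤ C) ∧
      ∑ ω, p ω * -Real.logb 2 (Q (A ω) (B ω)) ≤ condEntropy p A B + δ := by
  have hc : (0 : ℝ) < Fintype.card α := by exact_mod_cast Fintype.card_pos
  set t : ℝ := (2 : ℝ) ^ (-δ) with ht
  have ht0 : 0 < t := by positivity
  have ht1 : t < 1 := Real.rpow_lt_one_of_one_lt_of_neg one_lt_two (by linarith)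
  have hlogt : Real.logb 2 t = -δ := by rw [ht, Real.logb_rpow two_pos (by norm_num)]
  set P : α → β → ℝ := fun a b =>
    prob p (fun ω => A ω = a ∧ B ω = b) / prob p (fun ω => B ω = b) with hP
  have hP0 : ∀ a b, 0 ≤ P a b := fun a b => div_nonneg (prob_nonneg hp _) (prob_nonneg hp _)
  set m : ℝ := (1 - t) / Fintype.card α with hm
  have hm0 : 0 < m := div_pos (by linarith) hc
  have hm1 : m ≤ 1 := by
    rw [hm, div_le_one hc]
    have : (1 : ℝ) ≤ Fintype.card α := by exact_mod_cast Fintype.card_pos (α := α)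
    linarith
  refine ⟨fun a b => t * P a b + m, -Real.logb 2 m, ?_, fun a b => ?_, fun b => ?_, fun a b => ?_,
    ?_⟩
  · exact neg_nonneg.2 (Real.logb_nonpos one_lt_two hm0.le hm1)
  · have := mul_nonneg ht0.le (hP0 a b)
    linarith
  · rw [Finset.sum_add_distrib, ← Finset.mul_sum]
    have h1 : ∑ a, P a b ≤ 1 := sum_prob_div_le_one A B b
    have h2 : ∑ _a : α, m = 1 - t := by
      simp only [Finset.sum_const, Finset.card_univ, nsmul_eq_mul, hm]
      field_simp
    rw [h2]
    nlinarith
  · refine neg_le_neg (Real.logb_le_logb_of_le one_lt_two hm0 ?_)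
    have := mul_nonneg ht0.le (hP0 a b)
    linarith
  · rw [condEntropy_eq_sum, ← Finset.sum_neg_distrib]
    have h1 : δ = ∑ ω, p ω * δ := by rw [← Finset.sum_mul, hp1, one_mul]
    rw [h1, ← Finset.sum_add_distrib]
    refine Finset.sum_le_sum fun ω _ => ?_
    rcases (hp ω).eq_or_lt with h | h
    · simp [← h]
    have hPpos : 0 < P (A ω) (B ω) := div_pos (prob_pos hp h ⟨rfl, rfl⟩) (prob_pos hp h rfl)
    have h2 : Real.logb 2 (t * P (A ω) (B ω)) ≤ Real.logb 2 (t * P (A ω) (B ω) + m) :=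
      Real.logb_le_logb_of_le one_lt_two (by positivity) (by linarith)
    rw [Real.logb_mul ht0.ne' hPpos.ne', hlogt] at h2
    have h3 := mul_le_mul_of_nonneg_left h2 h.le
    simp only [hP] at h3 ⊢
    linarith

lemma IsMarkovChain.comp_left {W : Ω → α} {Y : Ω → β} {U : Ω → γ} [Fintype α]
    (h : IsMarkovChain p W Y U) (f : α → δ) : IsMarkovChain p (fun ω => f (W ω)) Y U := by
  classical
  intro a b c
  rw [prob_comp_and W f, prob_comp_and W f, Finset.sum_mul, Finset.sum_mul]
  refine Finset.sum_congr rfl fun w _ => ?_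
  linear_combination (if f w = a then (1 : ℝ) else 0) * h w b c

/-- In a Markov chain `W – Y – U`, `H(W,Y,U) + H(Y) = H(W,Y) + H(Y,U)`. -/
lemma IsMarkovChain.entropy_add {W : Ω → α} {Y : Ω → β} {U : Ω → γ} (hp : ∀ ω, 0 ≤ p ω)
    (h : IsMarkovChain p W Y U) :
    entropy p (fun ω => (W ω, Y ω, U ω)) + entropy p Y =
      entropy p (fun ω => (W ω, Y ω)) + entropy p (fun ω => (Y ω, U ω)) := by
  unfold entropy
  rw [← neg_add, ← neg_add, ← Finset.sum_add_distrib, ← Finset.sum_add_distrib]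
  congr 1
  refine Finset.sum_congr rfl fun ω _ => ?_
  rcases (hp ω).eq_or_lt with h0 | h0
  · simp [← h0]
  simp only [Prod.mk.injEq]
  have h1 : 0 < prob p (fun ω' => W ω' = W ω ∧ Y ω' = Y ω ∧ U ω' = U ω) :=
    prob_pos hp h0 ⟨rfl, rfl, rfl⟩
  have h2 : 0 < prob p (fun ω' => Y ω' = Y ω) := prob_pos hp h0 rfl
  have h3 : 0 < prob p (fun ω' => W ω' = W ω ∧ Y ω' = Y ω) := prob_pos hp h0 ⟨rfl, rfl⟩
  have h4 : 0 < prob p (fun ω' => Y ω' = Y ω ∧ U ω' = U ω) := prob_pos hp h0 ⟨rfl, rfl⟩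
  rw [← mul_add, ← mul_add, ← Real.logb_mul h1.ne' h2.ne', ← Real.logb_mul h3.ne' h4.ne', h]

/-- A lower bound on the equivocation of `X` for an observer of `E` and of a message determined by
an index `v Y` and a further part `K`. Only upper bounds on conditional entropies given the index
are needed to use it: `H(X|E,v)` is rewritten as `H(X,E,Y) - H(v) - H(Y|X,E,v) - H(E|v)`, and
revealing `K` as well costs at most its length. -/
lemma le_condEntropy_of_message {χ ε ν κ ι : Type*} [Fintype χ] [Fintype β] [Fintype ε]
    [Fintype ν] [Fintype κ] [Fintype ι] (hp : ∀ ω, 0 ≤ p ω) (hp1 : ∑ ω, p ω = 1)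
    (X : Ω → χ) (Y : Ω → β) (E : Ω → ε) (v : β → ν) (K : Ω → κ) (j : ν × κ → ι) :
    entropy p (fun ω => ((X ω, E ω), Y ω)) - Real.logb 2 (Fintype.card ν)
        - condEntropy p Y (fun ω => ((X ω, E ω), v (Y ω)))
        - condEntropy p E (fun ω => ((), v (Y ω))) - Real.logb 2 (Fintype.card κ) ≤
      condEntropy p X (fun ω => (E ω, j (v (Y ω), K ω))) := by
  have h1 := condEntropy_le_condEntropy_comp hp hp1 X (fun ω => (E ω, v (Y ω), K ω))
    (fun x => (x.1, j x.2))
  have h2 := condEntropy_le_logb_card hp hp1 K (fun ω => (E ω, v (Y ω)))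
  have h3 := condEntropy_le_logb_card hp hp1 (fun ω => v (Y ω)) (fun _ => ())
  have h4 := condEntropy_nonneg hp K (fun ω => (X ω, E ω, v (Y ω)))
  simp only [condEntropy_eq_entropy_sub hp] at h1 h2 h3 h4 ⊢
  have e1 : entropy p (fun ω => (X ω, E ω, v (Y ω), K ω)) =
      entropy p (fun ω => (K ω, X ω, E ω, v (Y ω))) := entropy_congr fun ω ω' => by
    simp only [Prod.mk.injEq]; tauto
  have e2 : entropy p (fun ω => (E ω, v (Y ω), K ω)) =
      entropy p (fun ω => (K ω, E ω, v (Y ω))) := entropy_congr fun ω ω' => by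
    simp only [Prod.mk.injEq]; tauto
  have e3 : entropy p (fun ω => (Y ω, (X ω, E ω), v (Y ω))) =
      entropy p (fun ω => ((X ω, E ω), Y ω)) := entropy_congr fun ω ω' => by
    simp only [Prod.mk.injEq]
    constructor
    · tauto
    · rintro ⟨h, h'⟩; simp [h, h']
  have e4 : entropy p (fun ω => ((X ω, E ω), v (Y ω))) =
      entropy p (fun ω => (X ω, E ω, v (Y ω))) := entropy_congr fun ω ω' => by
    simp only [Prod.mk.injEq]; tauto
  have e5 : entropy p (fun ω => (E ω, (), v (Y ω))) =
      entropy p (fun ω => (E ω, v (Y ω))) := entropy_congr fun ω ω' => by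
    simp only [Prod.mk.injEq]; tauto
  have e6 : entropy p (fun ω => ((), v (Y ω))) = entropy p (fun ω => (v (Y ω), ())) :=
    entropy_congr fun ω ω' => by simp only [Prod.mk.injEq]; tauto
  have e7 : entropy p (fun _ : Ω => ()) = 0 := by
    simp [entropy, prob_true, hp1]
  linarith

end Entropy

/-! ### Independent identically distributed blocks -/

section Iid

variable {Ω α β γ : Type*} {p : Ω → ℝ}

lemma iidLaw_nonneg (hp : ∀ ω, 0 ≤ p ω) (n : ℕ) (ω : Fin n → Ω) : 0 ≤ iidLaw p n ω :=
  Finset.prod_nonneg fun i _ => hp (ω i)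

lemma block_eq_iff {n : ℕ} {A : Ω → α} {ω : Fin n → Ω} {a : Fin n → α} :
    block A n ω = a ↔ ∀ i, A (ω i) = a i := funext_iff

variable [Fintype Ω]

/-- Expectations of products factor under the i.i.d. law. -/
lemma sum_iidLaw_mul_prod (n : ℕ) (h : Fin n → Ω → ℝ) :
    ∑ ω, iidLaw p n ω * ∏ i, h i (ω i) = ∏ i, ∑ ω, p ω * h i ω := by
  classical
  rw [Finset.prod_univ_sum, Fintype.piFinset_univ]
  simp only [iidLaw, Finset.prod_mul_distrib]

lemma sum_iidLaw (hp1 : ∑ ω, p ω = 1) (n : ℕ) : ∑ ω, iidLaw p n ω = 1 := by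
  have := sum_iidLaw_mul_prod (p := p) n (fun _ _ => 1)
  simpa [hp1] using this

lemma sum_iidLaw_mul_sum (hp1 : ∑ ω, p ω = 1) (n : ℕ) (φ : Ω → ℝ) :
    ∑ ω, iidLaw p n ω * ∑ i, φ (ω i) = n * ∑ ω, p ω * φ ω := by
  simp_rw [Finset.mul_sum]
  rw [Finset.sum_comm]
  have : ∀ i : Fin n, ∑ ω, iidLaw p n ω * φ (ω i) = ∑ ω, p ω * φ ω := fun i => by
    have h := sum_iidLaw_mul_prod (p := p) n (fun j ω => if j = i then φ ω else 1)
    simp only [Finset.prod_ite_eq', Finset.mem_univ, if_true] at h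
    rw [h, Finset.prod_eq_single i]
    · simp
    · intro j _ hj; simp [hj, hp1]
    · simp
  rw [Finset.sum_congr rfl fun i _ => this i]
  simp [Finset.mul_sum]

lemma prob_iidLaw_forall (n : ℕ) (S : Fin n → Ω → Prop) :
    prob (iidLaw p n) (fun ω => ∀ i, S i (ω i)) = ∏ i, prob p (S i) := by
  classical
  simp_rw [prob_eq_sum_mul]
  rw [← sum_iidLaw_mul_prod]
  refine Finset.sum_congr rfl fun ω _ => ?_
  rw [Finset.prod_ite_zero]
  simp

lemma prob_block (n : ℕ) (A : Ω → α) (a : Fin n → α) :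
    prob (iidLaw p n) (fun ω => block A n ω = a) = ∏ i, prob p (fun ω => A ω = a i) := by
  rw [← prob_iidLaw_forall n (fun i ω => A ω = a i)]
  exact prob_congr fun ω => block_eq_iff

lemma prob_block_and_block (n : ℕ) (A : Ω → α) (B : Ω → β) (a : Fin n → α) (b : Fin n → β) :
    prob (iidLaw p n) (fun ω => block A n ω = a ∧ block B n ω = b) =
      ∏ i, prob p (fun ω => A ω = a i ∧ B ω = b i) := by
  rw [← prob_iidLaw_forall n (fun i ω => A ω = a i ∧ B ω = b i)]
  exact prob_congr fun ω => by rw [block_eq_iff, block_eq_iff, ← forall_and]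

lemma IsMarkovChain.iidLaw_block {W : Ω → α} {Y : Ω → β} {U : Ω → γ} (h : IsMarkovChain p W Y U)
    (n : ℕ) :
    IsMarkovChain (iidLaw p n) (block W n) (block Y n) (block U n) := by
  intro a b c
  have h3 : prob (iidLaw p n) (fun ω => block W n ω = a ∧
      block Y n ω = b ∧ block U n ω = c) =
      ∏ i, prob p (fun ω => W ω = a i ∧ Y ω = b i ∧ U ω = c i) := by
    rw [← prob_iidLaw_forall n (fun i ω => W ω = a i ∧ Y ω = b i ∧ U ω = c i)]
    exact prob_congr fun ω => by
      rw [block_eq_iff, block_eq_iff, block_eq_iff, ← forall_and, ← forall_and]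
  rw [h3, prob_block, prob_block_and_block, prob_block_and_block, ← Finset.prod_mul_distrib,
    ← Finset.prod_mul_distrib]
  exact Finset.prod_congr rfl fun i _ => h _ _ _

lemma entropy_block (hp : ∀ ω, 0 ≤ p ω) (hp1 : ∑ ω, p ω = 1) (n : ℕ) (A : Ω → α) :
    entropy (iidLaw p n) (block A n) = n * entropy p A := by
  unfold entropy
  rw [mul_neg, ← sum_iidLaw_mul_sum hp1]
  congr 1
  refine Finset.sum_congr rfl fun ω _ => ?_
  rcases (iidLaw_nonneg hp n ω).eq_or_lt with h | h
  · simp [← h]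
  have hω : ∀ i, 0 < p (ω i) := fun i =>
    (hp _).lt_of_ne' fun h0 => h.ne' (Finset.prod_eq_zero (Finset.mem_univ i) h0)
  rw [prob_block, Real.logb_prod]
  · rfl
  · exact fun i _ => (prob_pos (S := fun ω' => A ω' = A (ω i)) hp (hω i) rfl).ne'

/-- The weak law of large numbers (upper tail), by Chernoff's bound: for small `t > 0` the moment
generating function `E[exp (t (φ - E φ - δ))]` is less than one. -/
lemma tendsto_prob_lt_sum (hp : ∀ ω, 0 ≤ p ω) (hp1 : ∑ ω, p ω = 1) (φ : Ω → ℝ) {δ a : ℝ}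
    (hδ : 0 < δ) (ha : ∑ ω, p ω * φ ω + δ ≤ a) :
    Tendsto (fun n : ℕ => prob (iidLaw p n) (fun ω => n * a < ∑ i, φ (ω i))) atTop (𝓝 0) := by
  classical
  obtain ⟨K, hK1, hK⟩ : ∃ K : ℝ, 1 ≤ K ∧ ∀ ω, |φ ω - a| ≤ K := by
    refine ⟨1 + ∑ ω, |φ ω - a|, ?_, fun ω => ?_⟩
    · have := Finset.sum_nonneg (s := Finset.univ) fun ω (_ : ω ∈ _) => abs_nonneg (φ ω - a)
      linarith
    · have := Finset.single_le_sum (f := fun ω => |φ ω - a|) (fun ω _ => abs_nonneg _)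
        (Finset.mem_univ ω)
      linarith
  set t : ℝ := min (1 / K) (δ / (2 * K ^ 2)) with ht
  have hK0 : 0 < K := by linarith
  have ht0 : 0 < t := by positivity
  have htK : t * K ≤ 1 := by
    have : t ≤ 1 / K := min_le_left _ _
    rwa [le_div_iff₀ hK0] at this
  have htδ : t * K ^ 2 ≤ δ / 2 := by
    have : t ≤ δ / (2 * K ^ 2) := min_le_right _ _
    rw [le_div_iff₀ (by positivity)] at this
    linarith
  set r : ℝ := ∑ ω, p ω * Real.exp (t * (φ ω - a)) with hr
  have hr0 : 0 ≤ r := Finset.sum_nonneg fun ω _ => mul_nonneg (hp ω) (Real.exp_pos _).le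
  have hr1 : r < 1 := by
    have h1 : ∀ ω, Real.exp (t * (φ ω - a)) ≤ 1 + t * (φ ω - a) + t * (δ / 2) := fun ω => by
      have hx : |t * (φ ω - a)| ≤ 1 := by
        rw [abs_mul, abs_of_pos ht0]
        exact (mul_le_mul_of_nonneg_left (hK ω) ht0.le).trans htK
      have h2 := (abs_le.1 (Real.abs_exp_sub_one_sub_id_le hx)).2
      have h3 : (φ ω - a) ^ 2 ≤ K ^ 2 := sq_le_sq' (abs_le.1 (hK ω)).1 (abs_le.1 (hK ω)).2
      have h4 : (t * (φ ω - a)) ^ 2 ≤ t * (δ / 2) := by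
        calc (t * (φ ω - a)) ^ 2 = t * (t * (φ ω - a) ^ 2) := by ring
          _ ≤ t * (t * K ^ 2) := by gcongr
          _ ≤ t * (δ / 2) := by gcongr
      linarith
    have h2 : r ≤ ∑ ω, p ω * (1 + t * (φ ω - a) + t * (δ / 2)) :=
      Finset.sum_le_sum fun ω _ => mul_le_mul_of_nonneg_left (h1 ω) (hp ω)
    have h3 : ∑ ω, p ω * (1 + t * (φ ω - a) + t * (δ / 2)) =
        (1 - t * a + t * (δ / 2)) * ∑ ω, p ω + t * ∑ ω, p ω * φ ω := by
      rw [Finset.mul_sum, Finset.mul_sum, ← Finset.sum_add_distrib]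
      exact Finset.sum_congr rfl fun ω _ => by ring
    rw [h3, hp1] at h2
    nlinarith
  refine squeeze_zero (fun n => prob_nonneg (iidLaw_nonneg hp n) _) (fun n => ?_)
    (tendsto_pow_atTop_nhds_zero_of_lt_one hr0 hr1)
  have hrn : r ^ n = ∑ ω, iidLaw p n ω * ∏ i, Real.exp (t * (φ (ω i) - a)) := by
    rw [sum_iidLaw_mul_prod n (fun _ ω => Real.exp (t * (φ ω - a)))]
    simp [hr]
  rw [hrn, prob_eq_sum_mul]
  refine Finset.sum_le_sum fun ω _ => mul_le_mul_of_nonneg_left ?_ (iidLaw_nonneg hp n ω)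
  rw [← Real.exp_sum]
  split_ifs with h
  · refine Real.one_le_exp ?_
    rw [← Finset.mul_sum, Finset.sum_sub_distrib]
    refine mul_nonneg ht0.le ?_
    simp only [Finset.sum_const, Finset.card_univ, Fintype.card_fin, nsmul_eq_mul]
    linarith
  · exact (Real.exp_pos _).le

end Iid

/-! ### Codelengths of blocks -/

section Kernel

variable {Ω α β γ : Type*}

lemma sum_prod_le_one [Fintype α] {n : ℕ} {f : Fin n → α → ℝ} (hf0 : ∀ i a, 0 ≤ f i a)
    (hf1 : ∀ i, ∑ a, f i a ≤ 1) : ∑ a : Fin n → α, ∏ i, f i (a i) ≤ 1 := by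
  have h := Finset.prod_univ_sum (fun _ : Fin n => (Finset.univ : Finset α)) f
  rw [Fintype.piFinset_univ] at h
  rw [← h]
  exact Finset.prod_le_one (fun i _ => Finset.sum_nonneg fun a _ => hf0 i a) fun i _ => hf1 i

/-- At most `2 ^ s` sequences have `Q`-codelength at most `s` bits given the side sequence `b`. -/
lemma card_codelength_le [Fintype α] {Q : α → β → ℝ} (hQ0 : ∀ a b, 0 < Q a b)
    (hQ1 : ∀ b, ∑ a, Q a b ≤ 1) {n : ℕ} (b : Fin n → β) (s : ℝ) (T : Finset (Fin n → α))
    (hT : ∀ a ∈ T, ∑ i, -Real.logb 2 (Q (a i) (b i)) ≤ s) : (T.card : ℝ) ≤ 2 ^ s := by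
  classical
  have h1 : ∑ a : Fin n → α, ∏ i, Q (a i) (b i) ≤ 1 :=
    sum_prod_le_one (f := fun i a => Q a (b i)) (fun i a => (hQ0 _ _).le) fun i => hQ1 _
  have h2 : ∀ a ∈ T, (2 : ℝ) ^ (-s) ≤ ∏ i, Q (a i) (b i) := fun a ha => by
    have hpos : 0 < ∏ i, Q (a i) (b i) := Finset.prod_pos fun i _ => hQ0 _ _
    rw [← Real.le_logb_iff_rpow_le one_lt_two hpos, Real.logb_prod _ _ fun i _ => (hQ0 _ _).ne']
    have := hT a ha
    rw [Finset.sum_neg_distrib] at this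
    linarith
  have h3 : (T.card : ℝ) * 2 ^ (-s) ≤ 1 := by
    calc (T.card : ℝ) * 2 ^ (-s) = ∑ a ∈ T, (2 : ℝ) ^ (-s) := by simp
      _ ≤ ∑ a ∈ T, ∏ i, Q (a i) (b i) := Finset.sum_le_sum h2
      _ ≤ ∑ a : Fin n → α, ∏ i, Q (a i) (b i) := Finset.sum_le_sum_of_subset_of_nonneg (Finset.subset_univ _)
          fun a _ _ => Finset.prod_nonneg fun i _ => (hQ0 _ _).le
      _ ≤ 1 := h1
  rwa [Real.rpow_neg two_pos.le, ← div_eq_mul_inv, div_le_one (by positivity)] at h3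

/-- A block `A` whose codelength, given the side sequence `b B` and the codeword `c V`, exceeds `s` bits only
with probability `θ` has conditional entropy at most `s`, up to `θ` times the largest possible
codelength. -/
lemma condEntropy_le_of_prob_codelength_le [Fintype Ω] [Fintype α] {ξ ν : Type*}
    [Fintype ξ] [Fintype ν] {p : Ω → ℝ} (hp : ∀ ω, 0 ≤ p ω) (hp1 : ∑ ω, p ω = 1) {Q : α → β × γ → ℝ}
    (hQ0 : ∀ a b, 0 < Q a b) (hQ1 : ∀ b, ∑ a, Q a b ≤ 1) {C : ℝ} (hC : 0 ≤ C)
    (hQC : ∀ a b, -Real.logb 2 (Q a b) ≤ C) {n : ℕ} (A : Ω → Fin n → α) (B : Ω → ξ)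
    (b : ξ → Fin n → β) (V : Ω → ν) (c : ν → Fin n → γ) {s θ : ℝ} (hs : 0 ≤ s)
    (h : prob p (fun ω => s < ∑ i, -Real.logb 2 (Q (A ω i) (b (B ω) i, c (V ω) i))) ≤ θ) :
    condEntropy p A (fun ω => (B ω, V ω)) ≤ s + n * C * θ := by
  classical
  refine (condEntropy_le_sum_neg_logb hp hp1 A (fun ω => (B ω, V ω))
    (fun (a : Fin n → α) (x : ξ × ν) => ∏ i, Q (a i) (b x.1 i, c x.2 i))
    (fun a b => Finset.prod_nonneg fun i _ => (hQ0 _ _).le)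
    (fun ω _ => Finset.prod_pos fun i _ => hQ0 _ _) fun x => ?_).trans ?_
  · exact sum_prod_le_one (f := fun i a => Q a (b x.1 i, c x.2 i)) (fun i a => (hQ0 _ _).le)
      fun i => hQ1 _
  · have : ∀ ω, -Real.logb 2 (∏ i, Q (A ω i) (b (B ω) i, c (V ω) i)) =
        ∑ i, -Real.logb 2 (Q (A ω i) (b (B ω) i, c (V ω) i)) := fun ω => by
      rw [Real.logb_prod _ _ fun i _ => (hQ0 _ _).ne', Finset.sum_neg_distrib]
    simp only [this]
    refine sum_mul_le_of_prob_lt_le hp hp1 hs (by positivity) (fun ω => ?_) h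
    refine (Finset.sum_le_sum fun i _ => hQC _ _).trans_eq ?_
    simp

end Kernel

/-! ### Covering by random codebooks -/

section Covering

lemma exp_neg_mul_le {t x : ℝ} (ht0 : 0 ≤ t) (ht1 : t ≤ 1) :
    Real.exp (-(t * x)) ≤ 1 - t + Real.exp (-x) := by
  have h := convexOn_exp.2 (Set.mem_univ 0) (Set.mem_univ (-x)) (sub_nonneg.2 ht1) ht0 (by ring)
  simp only [smul_eq_mul, mul_zero, zero_add, Real.exp_zero, mul_one, mul_neg] at h
  nlinarith [Real.exp_pos (-x)]

variable {Ω 𝒲 𝒴 𝒰 : Type*} [Fintype Ω] [Fintype 𝒲] [Fintype 𝒴] [Fintype 𝒰] {p : Ω → ℝ}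

/-- Random coding for a single source symbol: if `M` codewords are drawn from the law of `U`, the
average probability that none of them is in the good set `G` with `Y` is at most the probability
that `(Y, U)` is not in `G`, up to a term that is doubly exponentially small once `M` exceeds the
bound `L` on the density `P(y,u) / P(y) P(u)` over `G`. -/
lemma exists_codebook (hp : ∀ ω, 0 ≤ p ω) (hp1 : ∑ ω, p ω = 1) (Y : Ω → 𝒴) (U : Ω → 𝒰)
    (G : 𝒴 → 𝒰 → Prop) {L : ℝ} (hL : 0 < L)
    (hG : ∀ y u, G y u → prob p (fun ω => U ω = u ∧ Y ω = y) ≤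
      L * (prob p (fun ω => Y ω = y) * prob p (fun ω => U ω = u))) (M : ℕ) :
    ∃ c : Fin M → 𝒰, prob p (fun ω => ∀ i, ¬ G (Y ω) (c i)) ≤
      prob p (fun ω => ¬ G (Y ω) (U ω)) + Real.exp (-(M / L)) := by
  classical
  set PY : 𝒴 → ℝ := fun y => prob p (fun ω => Y ω = y) with hPY
  set PU : 𝒰 → ℝ := fun u => prob p (fun ω => U ω = u) with hPU
  have hPY0 : ∀ y, 0 ≤ PY y := fun y => prob_nonneg hp _
  have hPU0 : ∀ u, 0 ≤ PU u := fun u => prob_nonneg hp _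
  have hPU1 : ∑ u, PU u = 1 := by rw [hPU, sum_prob, hp1]
  set e : ℝ := Real.exp (-(M / L)) with he
  -- `t y` is the probability of `Y = y` and `G`, so the conditional probability of `G` is `t / PY`.
  set t : 𝒴 → ℝ := fun y => prob p (fun ω => Y ω = y ∧ G (Y ω) (U ω)) with ht
  have ht0 : ∀ y, 0 ≤ t y := fun y => prob_nonneg hp _
  have htPY : ∀ y, t y ≤ PY y := fun y => prob_mono hp fun ω h => h.1
  have hkey : ∀ y, PY y * prob PU (fun u => ¬ G y u) ^ M ≤ PY y - t y + PY y * e := by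
    intro y
    rcases (hPY0 y).eq_or_lt with h0 | h0
    · have := htPY y
      rw [← h0] at this ⊢
      linarith
    have ht' : t y = ∑ u, prob p (fun ω => U ω = u ∧ Y ω = y) * (if G y u then 1 else 0) := by
      rw [sum_prob_and_mul U (fun ω => Y ω = y) (fun u => if G y u then (1 : ℝ) else 0), ht]
      simp only [prob_eq_sum_mul]
      refine Finset.sum_congr rfl fun ω _ => ?_
      by_cases hy : Y ω = y
      · by_cases hg : G y (U ω) <;> simp [hy, hg]
      · simp [hy]
    have h1 : t y ≤ L * (PY y * prob PU (fun u => G y u)) := by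
      rw [ht', prob_eq_sum_mul, Finset.mul_sum, Finset.mul_sum]
      refine Finset.sum_le_sum fun u _ => ?_
      by_cases hg : G y u
      · simpa [hg] using hG y u hg
      · simp [hg]
    have h2 : t y / PY y / L ≤ prob PU (fun u => G y u) := by
      rw [div_le_iff₀ hL, div_le_iff₀ h0]
      linarith
    have h3 : prob PU (fun u => ¬ G y u) ≤ Real.exp (-(t y / PY y / L)) := by
      rw [prob_not, hPU1]
      have := Real.add_one_le_exp (-(t y / PY y / L))
      linarith
    have h4 : prob PU (fun u => ¬ G y u) ^ M ≤ 1 - t y / PY y + e := by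
      calc _ ≤ Real.exp (-(t y / PY y / L)) ^ M := pow_le_pow_left₀ (prob_nonneg hPU0 _) h3 M
        _ = Real.exp (-(t y / PY y * (M / L))) := by
          rw [← Real.exp_nat_mul]
          congr 1
          ring
        _ ≤ _ := exp_neg_mul_le (div_nonneg (ht0 y) h0.le) ((div_le_one h0).2 (htPY y))
    calc _ ≤ PY y * (1 - t y / PY y + e) := mul_le_mul_of_nonneg_left h4 h0.le
      _ = PY y - t y + PY y * e := by field_simp
  refine exists_le_of_sum_mul_le (iidLaw_nonneg hPU0 M) (sum_iidLaw hPU1 M) ?_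
  have hF : ∀ c : Fin M → 𝒰, prob p (fun ω => ∀ i, ¬ G (Y ω) (c i)) =
      ∑ y, PY y * (if ∀ i, ¬ G y (c i) then 1 else 0) := fun c => by
    rw [hPY, sum_prob_mul Y (fun y => if ∀ i, ¬ G y (c i) then (1 : ℝ) else 0), prob_eq_sum_mul]
    exact Finset.sum_congr rfl fun ω _ => by congr
  calc ∑ c, iidLaw PU M c * prob p (fun ω => ∀ i, ¬ G (Y ω) (c i))
      = ∑ y, PY y * prob (iidLaw PU M) (fun c => ∀ i, ¬ G y (c i)) := by
        simp_rw [hF, prob_eq_sum_mul, Finset.mul_sum]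
        rw [Finset.sum_comm]
        exact Finset.sum_congr rfl fun y _ => Finset.sum_congr rfl fun c _ => by
          rw [mul_left_comm]
          congr
    _ = ∑ y, PY y * prob PU (fun u => ¬ G y u) ^ M := by
        refine Finset.sum_congr rfl fun y _ => ?_
        rw [prob_iidLaw_forall M (fun _ u => ¬ G y u)]
        simp
    _ ≤ ∑ y, (PY y - t y + PY y * e) := Finset.sum_le_sum fun y _ => hkey y
    _ = prob p (fun ω => ¬ G (Y ω) (U ω)) + e := by
        rw [Finset.sum_add_distrib, Finset.sum_sub_distrib, ← Finset.sum_mul, sum_prob, sum_prob_and,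
          hp1, prob_not, hp1]
        ring

/-- A joint covering lemma: in a Markov chain `W – Y – U`, the variable `U` can be replaced by a
quantization `c (v Y)` of `Y` to `M` values in such a way that events `B` which are rare for
`(W, Y, U)` stay rare. A pair `(y, u)` counts as good for the covering if the conditional
probability of `B` given `Y = y`, with `u` in the place of `U`, is at most `s`. -/
lemma IsMarkovChain.exists_quantizer (hp : ∀ ω, 0 ≤ p ω) (hp1 : ∑ ω, p ω = 1)
    {W : Ω → 𝒲} {Y : Ω → 𝒴} {U : Ω → 𝒰} (h : IsMarkovChain p W Y U)
    (B : 𝒲 → 𝒴 → 𝒰 → Prop) {L s : ℝ} (hL : 0 < L) (hs : 0 < s) {M : ℕ} (hM : 0 < M) :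
    ∃ (c : Fin M → 𝒰) (v : 𝒴 → Fin M),
      prob p (fun ω => B (W ω) (Y ω) (c (v (Y ω)))) ≤
        s + prob p (fun ω => B (W ω) (Y ω) (U ω)) / s
          + prob p (fun ω => L * (prob p (fun ω' => Y ω' = Y ω) * prob p (fun ω' => U ω' = U ω)) <
              prob p (fun ω' => U ω' = U ω ∧ Y ω' = Y ω))
          + Real.exp (-(M / L)) := by
  classical
  set f : 𝒴 → 𝒰 → ℝ := fun y u =>
    prob p (fun ω => Y ω = y ∧ B (W ω) y u) / prob p (fun ω => Y ω = y) with hf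
  have hf0 : ∀ y u, 0 ≤ f y u := fun y u => div_nonneg (prob_nonneg hp _) (prob_nonneg hp _)
  have hf1 : ∀ y u, f y u ≤ 1 := fun y u =>
    div_le_one_of_le₀ (prob_mono hp fun ω h => h.1) (prob_nonneg hp _)
  have hYB : ∀ y u, prob p (fun ω => Y ω = y) * f y u = prob p (fun ω => Y ω = y ∧ B (W ω) y u) := by
    intro y u
    rcases (prob_nonneg hp (fun ω => Y ω = y)).eq_or_lt with h0 | h0
    · rw [← h0, zero_mul]
      exact (prob_nonneg hp _).antisymm (h0.symm ▸ prob_mono hp fun ω h => h.1)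
    · exact mul_div_cancel₀ _ h0.ne'
  -- by the Markov property, averaging `f` over `(Y, U)` gives the probability of `B`
  have hfB : ∑ ω, p ω * f (Y ω) (U ω) = prob p (fun ω => B (W ω) (Y ω) (U ω)) := by
    have hB : prob p (fun ω => B (W ω) (Y ω) (U ω)) = ∑ x : 𝒲 × 𝒴 × 𝒰,
        prob p (fun ω => (W ω, Y ω, U ω) = x) * (if B x.1 x.2.1 x.2.2 then 1 else 0) := by
      rw [sum_prob_mul (fun ω => (W ω, Y ω, U ω))
        (fun x => if B x.1 x.2.1 x.2.2 then (1 : ℝ) else 0), prob_eq_sum_mul]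
    rw [hB, ← sum_prob_mul (fun ω => (Y ω, U ω)) (fun x => f x.1 x.2), Fintype.sum_prod_type
      (f := fun x : 𝒲 × 𝒴 × 𝒰 =>
        prob p (fun ω => (W ω, Y ω, U ω) = x) * (if B x.1 x.2.1 x.2.2 then (1 : ℝ) else 0)),
      Finset.sum_comm]
    refine Finset.sum_congr rfl fun x _ => ?_
    obtain ⟨y, u⟩ := x
    simp only [Prod.mk.injEq]
    have h1 : prob p (fun ω => Y ω = y ∧ B (W ω) y u) =
        ∑ w, prob p (fun ω => W ω = w ∧ Y ω = y) * (if B w y u then 1 else 0) := by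
      rw [sum_prob_and_mul W (fun ω => Y ω = y) (fun w => if B w y u then (1 : ℝ) else 0),
        prob_eq_sum_mul]
      refine Finset.sum_congr rfl fun ω _ => ?_
      by_cases hy : Y ω = y <;> simp [hy]
    rcases (prob_nonneg hp (fun ω => Y ω = y)).eq_or_lt with h0 | h0
    · have h2 : prob p (fun ω => Y ω = y ∧ U ω = u) = 0 :=
        (prob_nonneg hp _).antisymm' (h0.symm ▸ prob_mono hp fun ω h => h.1)
      rw [h2, zero_mul]
      refine (Finset.sum_eq_zero fun w _ => ?_).symm
      have h3 : prob p (fun ω => W ω = w ∧ Y ω = y ∧ U ω = u) = 0 :=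
        (prob_nonneg hp _).antisymm' (h0.symm ▸ prob_mono hp fun ω h => h.2.1)
      rw [h3, zero_mul]
    · simp only [hf]
      rw [h1, mul_div_assoc', div_eq_iff h0.ne', Finset.mul_sum, Finset.sum_mul]
      refine Finset.sum_congr rfl fun w _ => ?_
      linear_combination -(if B w y u then (1 : ℝ) else 0) * h w y u
  set G : 𝒴 → 𝒰 → Prop := fun y u => f y u ≤ s ∧ prob p (fun ω => U ω = u ∧ Y ω = y) ≤
      L * (prob p (fun ω => Y ω = y) * prob p (fun ω => U ω = u)) with hG
  obtain ⟨c, hc⟩ := exists_codebook hp hp1 Y U G hL (fun y u h => h.2) M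
  have : Nonempty (Fin M) := ⟨⟨0, hM⟩⟩
  refine ⟨c, fun y => if hy : ∃ i, G y (c i) then hy.choose else Classical.arbitrary _, ?_⟩
  set v : 𝒴 → Fin M :=
    fun y => if hy : ∃ i, G y (c i) then hy.choose else Classical.arbitrary _ with hv
  have hvG : ∀ y, (∃ i, G y (c i)) → G y (c (v y)) := fun y hy => by
    simp only [hv, hy, dif_pos]
    exact hy.choose_spec
  have hnotG : prob p (fun ω => ¬ G (Y ω) (U ω)) ≤
      prob p (fun ω => B (W ω) (Y ω) (U ω)) / s
          + prob p (fun ω => L * (prob p (fun ω' => Y ω' = Y ω) * prob p (fun ω' => U ω' = U ω)) <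
              prob p (fun ω' => U ω' = U ω ∧ Y ω' = Y ω)) := by
    have h1 := mul_prob_lt_le hp (fun ω => hf0 (Y ω) (U ω)) s
    rw [hfB] at h1
    refine le_trans ?_ ((prob_or_le hp (fun ω => s < f (Y ω) (U ω)) _).trans
      (add_le_add_left ((le_div_iff₀' hs).2 h1) _))
    refine prob_mono hp fun ω hω => ?_
    simp only [hG, not_and_or, not_le] at hω
    exact hω
  have hmain : prob p (fun ω => B (W ω) (Y ω) (c (v (Y ω)))) =
      ∑ y, prob p (fun ω => Y ω = y) * f y (c (v y)) := by
    simp_rw [hYB]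
    rw [← sum_prob_and Y]
    refine Finset.sum_congr rfl fun y _ => prob_congr fun ω => ?_
    constructor
    · rintro ⟨rfl, h⟩; exact ⟨rfl, h⟩
    · rintro ⟨rfl, h⟩; exact ⟨rfl, h⟩
  rw [hmain, sum_prob_mul Y (fun y => f y (c (v y)))]
  calc ∑ ω, p ω * f (Y ω) (c (v (Y ω)))
      ≤ ∑ ω, (p ω * s + p ω * (if ∀ i, ¬ G (Y ω) (c i) then 1 else 0)) := by
        refine Finset.sum_le_sum fun ω _ => ?_
        rw [← mul_add]
        refine mul_le_mul_of_nonneg_left ?_ (hp ω)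
        split_ifs with hω
        · linarith [hf1 (Y ω) (c (v (Y ω)))]
        · push Not at hω
          linarith [(hvG _ hω).1]
    _ = s + prob p (fun ω => ∀ i, ¬ G (Y ω) (c i)) := by
        rw [Finset.sum_add_distrib, ← Finset.sum_mul, hp1, one_mul, prob_eq_sum_mul]
        exact congrArg (s + ·) (Finset.sum_congr rfl fun ω _ => by congr)
    _ ≤ _ := by linarith

end Covering

/-! ### Random binning -/

section Binning

lemma sum_ite_apply_eq_apply {α : Type*} [Fintype α] [DecidableEq α] {M : ℕ} [NeZero M] {a b : α}
    (hab : a ≠ b) :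
    (M : ℝ) * ∑ e : α → Fin M, (if e a = e b then (1 : ℝ) else 0) =
      Fintype.card (α → Fin M) := by
  -- adding a constant to the value at `a` permutes the functions
  have h1 : ∀ s : Fin M, ∑ e : α → Fin M, (if e a = e b then (1 : ℝ) else 0) =
      ∑ e : α → Fin M, (if e a + s = e b then (1 : ℝ) else 0) := fun s => by
    rw [← Equiv.sum_comp (Equiv.addRight (Pi.single a s : α → Fin M))]
    refine Finset.sum_congr rfl fun e _ => ?_
    simp [hab.symm]
  calc (M : ℝ) * ∑ e : α → Fin M, (if e a = e b then (1 : ℝ) else 0)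
      = ∑ s : Fin M, ∑ e : α → Fin M, (if e a + s = e b then (1 : ℝ) else 0) := by
        rw [← Finset.sum_congr rfl fun s _ => h1 s]
        simp
    _ = ∑ e : α → Fin M, ∑ s : Fin M, (if e a + s = e b then (1 : ℝ) else 0) := Finset.sum_comm
    _ = Fintype.card (α → Fin M) := by
        have : ∀ e : α → Fin M, ∑ s : Fin M, (if e a + s = e b then (1 : ℝ) else 0) = 1 := fun e => by
          rw [Finset.sum_eq_single (e b - e a)]
          · simp
          · intro s _ hs
            rw [if_neg]
            rintro h
            exact hs (by rw [← h]; simp)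
          · simp
        simp [this]

variable {Ω 𝒴 𝒵 𝒱 : Type*} [Fintype Ω] [Fintype 𝒴] [Fintype 𝒱] {p : Ω → ℝ}

/-- Slepian–Wolf coding by random binning in two layers: `Y` and its function `v Y` are binned
independently. A wrong typical candidate `y` with `v y ≠ v Y` survives with probability
`1 / (M₁ M₂)`, one with `v y = v Y` with probability `1 / M₂`. -/
lemma exists_binning [DecidableEq 𝒱] (hp : ∀ ω, 0 ≤ p ω) (hp1 : ∑ ω, p ω = 1) (Y : Ω → 𝒴)
    (Z : Ω → 𝒵) (v : 𝒴 → 𝒱) (T : 𝒵 → 𝒴 → Prop) [∀ z, DecidablePred (T z)] {N₁ N₂ : ℝ}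
    (hN₁ : ∀ z, ((Finset.univ.filter (T z)).card : ℝ) ≤ N₁)
    (hN₂ : ∀ z v₀, ((Finset.univ.filter (fun y => T z y ∧ v y = v₀)).card : ℝ) ≤ N₂)
    {M₁ M₂ : ℕ} (hM₁ : 0 < M₁) (hM₂ : 0 < M₂) :
    ∃ (e₁ : 𝒱 → Fin M₁) (e₂ : 𝒴 → Fin M₂) (d : Fin M₁ × Fin M₂ → 𝒵 → 𝒴),
      prob p (fun ω => d (e₁ (v (Y ω)), e₂ (Y ω)) (Z ω) ≠ Y ω) ≤
        prob p (fun ω => ¬ T (Z ω) (Y ω)) + (N₁ / (M₁ * M₂) + N₂ / M₂) := by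
  classical
  have : NeZero M₁ := ⟨hM₁.ne'⟩
  have : NeZero M₂ := ⟨hM₂.ne'⟩
  have hM₁' : (0 : ℝ) < M₁ := by exact_mod_cast hM₁
  have hM₂' : (0 : ℝ) < M₂ := by exact_mod_cast hM₂
  obtain ⟨ω₀⟩ : Nonempty Ω := by
    by_contra hne
    rw [not_nonempty_iff] at hne
    simp at hp1
  set K₁ : ℝ := (Fintype.card (𝒱 → Fin M₁) : ℝ) with hK₁
  set K₂ : ℝ := (Fintype.card (𝒴 → Fin M₂) : ℝ) with hK₂
  have hK₁0 : 0 < K₁ := by rw [hK₁]; exact_mod_cast Fintype.card_pos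
  have hK₂0 : 0 < K₂ := by rw [hK₂]; exact_mod_cast Fintype.card_pos
  -- the number of wrong candidates in the bin of `y`
  set F : (𝒱 → Fin M₁) × (𝒴 → Fin M₂) → 𝒵 → 𝒴 → ℝ := fun e z y =>
    ∑ y' ∈ Finset.univ.filter (T z), if y' ≠ y then
      (if e.1 (v y') = e.1 (v y) then 1 else 0) * (if e.2 y' = e.2 y then 1 else 0) else 0 with hF
  have hF0 : ∀ e z y, 0 ≤ F e z y := fun e z y =>
    Finset.sum_nonneg fun y' _ => by split_ifs <;> simp
  have havg : ∀ z y, ∑ e, (K₁ * K₂)⁻¹ * F e z y ≤ N₁ / (M₁ * M₂) + N₂ / M₂ := by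
    intro z y
    have hpair : ∀ y', ∑ e : (𝒱 → Fin M₁) × (𝒴 → Fin M₂), (K₁ * K₂)⁻¹ * (if y' ≠ y then
        (if e.1 (v y') = e.1 (v y) then (1 : ℝ) else 0) * (if e.2 y' = e.2 y then 1 else 0) else 0) ≤
        1 / (M₁ * M₂) + (if v y' = v y then 1 / (M₂ : ℝ) else 0) := by
      intro y'
      by_cases hy : y' = y
      · simp only [hy, ne_eq, not_true_eq_false, if_false, mul_zero, Finset.sum_const_zero, if_true]
        positivity
      · simp only [ne_eq, hy, not_false_eq_true, if_true]
        have hprod : ∑ e : (𝒱 → Fin M₁) × (𝒴 → Fin M₂),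
            (if e.1 (v y') = e.1 (v y) then (1 : ℝ) else 0) * (if e.2 y' = e.2 y then 1 else 0) =
            (∑ e : 𝒱 → Fin M₁, if e (v y') = e (v y) then (1 : ℝ) else 0) *
              ∑ e : 𝒴 → Fin M₂, if e y' = e y then (1 : ℝ) else 0 := by
          rw [Fintype.sum_prod_type, Finset.sum_mul_sum]
        rw [← Finset.mul_sum, hprod]
        have h2 := sum_ite_apply_eq_apply (M := M₂) hy
        rw [← hK₂] at h2
        have h2' : ∑ e : 𝒴 → Fin M₂, (if e y' = e y then (1 : ℝ) else 0) = K₂ / M₂ := by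
          rw [eq_div_iff hM₂'.ne', ← h2]; ring
        rw [h2']
        by_cases hvy : v y' = v y
        · simp only [hvy, if_true]
          have : ∑ _e : 𝒱 → Fin M₁, (1 : ℝ) = K₁ := by simp [hK₁]
          rw [this]
          have : (K₁ * K₂)⁻¹ * (K₁ * (K₂ / M₂)) = 1 / (M₂ : ℝ) := by field_simp
          rw [this]
          have : 0 ≤ 1 / ((M₁ : ℝ) * M₂) := by positivity
          linarith
        · have h1 := sum_ite_apply_eq_apply (M := M₁) hvy
          rw [← hK₁] at h1
          have h1' : ∑ e : 𝒱 → Fin M₁, (if e (v y') = e (v y) then (1 : ℝ) else 0) = K₁ / M₁ := by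
            rw [eq_div_iff hM₁'.ne', ← h1]; ring
          rw [h1']
          simp only [hvy, if_false, add_zero]
          apply le_of_eq
          field_simp
    calc ∑ e, (K₁ * K₂)⁻¹ * F e z y
        = ∑ y' ∈ Finset.univ.filter (T z), ∑ e : (𝒱 → Fin M₁) × (𝒴 → Fin M₂),
          (K₁ * K₂)⁻¹ * (if y' ≠ y then (if e.1 (v y') = e.1 (v y) then (1 : ℝ) else 0) *
            (if e.2 y' = e.2 y then 1 else 0) else 0) := by
          simp_rw [hF, Finset.mul_sum]
          exact Finset.sum_comm
      _ ≤ ∑ y' ∈ Finset.univ.filter (T z),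
          (1 / ((M₁ : ℝ) * M₂) + (if v y' = v y then 1 / (M₂ : ℝ) else 0)) :=
          Finset.sum_le_sum fun y' _ => hpair y'
      _ = (Finset.univ.filter (T z)).card * (1 / ((M₁ : ℝ) * M₂)) +
          (Finset.univ.filter (fun y' => T z y' ∧ v y' = v y)).card * (1 / (M₂ : ℝ)) := by
          rw [Finset.sum_add_distrib, ← Finset.sum_filter, Finset.filter_filter]
          simp only [Finset.sum_const, nsmul_eq_mul]
      _ ≤ N₁ * (1 / ((M₁ : ℝ) * M₂)) + N₂ * (1 / (M₂ : ℝ)) := by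
          gcongr
          · exact hN₁ z
          · exact hN₂ z _
      _ = _ := by ring
  obtain ⟨e, he⟩ : ∃ e, ∑ ω, p ω * F e (Z ω) (Y ω) ≤ N₁ / (M₁ * M₂) + N₂ / M₂ := by
    refine exists_le_of_sum_mul_le (p := fun _ => (K₁ * K₂)⁻¹) (fun _ => by positivity) ?_ ?_
    · simp only [Finset.sum_const, Finset.card_univ, Fintype.card_prod, nsmul_eq_mul, Nat.cast_mul]
      rw [← hK₁, ← hK₂]
      exact mul_inv_cancel₀ (by positivity)
    · calc _ = ∑ ω, p ω * ∑ e, (K₁ * K₂)⁻¹ * F e (Z ω) (Y ω) := by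
            simp_rw [Finset.mul_sum]
            rw [Finset.sum_comm]
            exact Finset.sum_congr rfl fun ω _ => Finset.sum_congr rfl fun e _ => by ring
        _ ≤ ∑ ω, p ω * (N₁ / (M₁ * M₂) + N₂ / M₂) :=
            Finset.sum_le_sum fun ω _ => mul_le_mul_of_nonneg_left (havg _ _) (hp ω)
        _ = _ := by rw [← Finset.sum_mul, hp1, one_mul]
  set d : Fin M₁ × Fin M₂ → 𝒵 → 𝒴 := fun j z =>
    if h : ∃ y, T z y ∧ (e.1 (v y), e.2 y) = j then h.choose else Y ω₀ with hd
  refine ⟨e.1, e.2, d, ?_⟩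
  calc prob p (fun ω => d (e.1 (v (Y ω)), e.2 (Y ω)) (Z ω) ≠ Y ω)
      ≤ ∑ ω, (p ω * (if ¬ T (Z ω) (Y ω) then 1 else 0) + p ω * F e (Z ω) (Y ω)) := by
        rw [prob_eq_sum_mul]
        refine Finset.sum_le_sum fun ω _ => ?_
        rw [← mul_add]
        refine mul_le_mul_of_nonneg_left ?_ (hp ω)
        by_cases hT : T (Z ω) (Y ω)
        swap
        · have := hF0 e (Z ω) (Y ω)
          simp only [hT, not_false_eq_true, if_true]
          split_ifs <;> linarith
        by_cases herr : d (e.1 (v (Y ω)), e.2 (Y ω)) (Z ω) = Y ω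
        · have := hF0 e (Z ω) (Y ω)
          simpa [hT, herr] using this
        simp only [hT, not_true_eq_false, if_false, zero_add, ne_eq, herr, not_false_eq_true, if_true]
        have hex : ∃ y, T (Z ω) y ∧ (e.1 (v y), e.2 y) = (e.1 (v (Y ω)), e.2 (Y ω)) :=
          ⟨Y ω, hT, rfl⟩
        have hdy : d (e.1 (v (Y ω)), e.2 (Y ω)) (Z ω) = hex.choose := by
          simp only [hd, hex, dif_pos]
        obtain ⟨h1, h2⟩ := hex.choose_spec
        rw [hdy] at herr
        generalize hex.choose = y' at h1 h2 herr
        rw [Prod.mk.injEq] at h2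
        have := Finset.single_le_sum (s := Finset.univ.filter (T (Z ω))) (f := fun y' =>
          if y' ≠ Y ω then (if e.1 (v y') = e.1 (v (Y ω)) then (1 : ℝ) else 0) *
            (if e.2 y' = e.2 (Y ω) then 1 else 0) else 0)
          (fun y' _ => by split_ifs <;> simp) (Finset.mem_filter.2 ⟨Finset.mem_univ _, h1⟩)
        refine le_trans ?_ this
        simp [h2.1, h2.2, herr]
    _ = prob p (fun ω => ¬ T (Z ω) (Y ω)) + ∑ ω, p ω * F e (Z ω) (Y ω) := by
        rw [Finset.sum_add_distrib, prob_eq_sum_mul]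
        congr 1
        exact Finset.sum_congr rfl fun ω _ => by congr
    _ ≤ _ := by linarith

end Binning

/-! ### Quantization of long blocks -/

section Asymptotics

lemma tendsto_two_rpow_nat_mul {δ : ℝ} (hδ : 0 < δ) :
    Tendsto (fun n : ℕ => (2 : ℝ) ^ ((n : ℝ) * δ)) atTop atTop := by
  have h := tendsto_pow_atTop_atTop_of_one_lt (Real.one_lt_rpow one_lt_two hδ)
  refine h.congr fun n => ?_
  rw [← Real.rpow_natCast, ← Real.rpow_mul two_pos.le, mul_comm]

lemma logb_ceil_two_rpow_le {x : ℝ} (hx : 0 ≤ x) : Real.logb 2 ⌈(2 : ℝ) ^ x⌉₊ ≤ x + 1 := by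
  have h1 : (1 : ℝ) ≤ 2 ^ x := Real.one_le_rpow one_le_two hx
  have h2 : (⌈(2 : ℝ) ^ x⌉₊ : ℝ) < 2 ^ x + 1 := Nat.ceil_lt_add_one (by linarith)
  have h3 : (2 : ℝ) ^ x ≤ ⌈(2 : ℝ) ^ x⌉₊ := Nat.le_ceil _
  rw [Real.logb_le_iff_le_rpow one_lt_two (by linarith), Real.rpow_add_one two_ne_zero]
  linarith

variable {Ω 𝒲 𝒴 𝒰 : Type*} [Fintype Ω] {p : Ω → ℝ}

/-- For most sequences the density `P(y,u) / P(y) P(u)` is at most `2 ^ (n (I(Y;U) + δ))`. -/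
lemma tendsto_prob_density_gt (hp : ∀ ω, 0 ≤ p ω) (hp1 : ∑ ω, p ω = 1) (Y : Ω → 𝒴) (U : Ω → 𝒰)
    {I δ : ℝ} (hI : I = entropy p Y + entropy p U - entropy p (fun ω => (U ω, Y ω)))
    (hδ : 0 < δ) :
    Tendsto (fun n : ℕ => prob (iidLaw p n) (fun ω => (2 : ℝ) ^ ((n : ℝ) * (I + δ)) *
      (prob (iidLaw p n) (fun ω' => block Y n ω' = block Y n ω) *
        prob (iidLaw p n) (fun ω' => block U n ω' = block U n ω)) <
      prob (iidLaw p n) (fun ω' => block U n ω' = block U n ω ∧ block Y n ω' = block Y n ω)))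
      atTop (𝓝 0) := by
  set φ : Ω → ℝ := fun ω => Real.logb 2 (prob p (fun ω' => U ω' = U ω ∧ Y ω' = Y ω)) -
    Real.logb 2 (prob p (fun ω' => Y ω' = Y ω)) - Real.logb 2 (prob p (fun ω' => U ω' = U ω)) with hφ
  have hE : ∑ ω, p ω * φ ω + δ ≤ I + δ := by
    rw [hI]
    apply le_of_eq
    simp only [entropy, hφ, mul_sub, Finset.sum_sub_distrib, Prod.mk.injEq]
    ring
  refine squeeze_zero (fun n => prob_nonneg (iidLaw_nonneg hp n) _) (fun n => ?_)
    (tendsto_prob_lt_sum hp hp1 φ hδ hE)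
  refine prob_mono_of_pos (iidLaw_nonneg hp n) fun ω hω h => ?_
  have hω : ∀ i, 0 < p (ω i) := fun i =>
    (hp _).lt_of_ne' fun h0 => hω.ne' (Finset.prod_eq_zero (Finset.mem_univ i) h0)
  have hY : ∀ i, 0 < prob p (fun ω' => Y ω' = Y (ω i)) := fun i => prob_pos hp (hω i) rfl
  have hU : ∀ i, 0 < prob p (fun ω' => U ω' = U (ω i)) := fun i => prob_pos hp (hω i) rfl
  have hUY : ∀ i, 0 < prob p (fun ω' => U ω' = U (ω i) ∧ Y ω' = Y (ω i)) :=
    fun i => prob_pos hp (hω i) ⟨rfl, rfl⟩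
  rw [prob_block, prob_block, prob_block_and_block] at h
  simp only [block] at h
  have hY' := Finset.prod_pos fun i (_ : i ∈ Finset.univ) => hY i
  have hU' := Finset.prod_pos fun i (_ : i ∈ Finset.univ) => hU i
  have h2 := Real.logb_lt_logb one_lt_two (by positivity) h
  rw [Real.logb_mul (by positivity) (by positivity), Real.logb_mul hY'.ne' hU'.ne',
    Real.logb_rpow two_pos (by norm_num), Real.logb_prod _ _ fun i _ => (hY i).ne',
    Real.logb_prod _ _ fun i _ => (hU i).ne', Real.logb_prod _ _ fun i _ => (hUY i).ne'] at h2
  simp only [hφ, Finset.sum_sub_distrib]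
  linarith

variable [Fintype 𝒲] [Fintype 𝒴] [Fintype 𝒰]

lemma entropy_pair_le (hp : ∀ ω, 0 ≤ p ω) (hp1 : ∑ ω, p ω = 1) (Y : Ω → 𝒴) (U : Ω → 𝒰) :
    entropy p (fun ω => (U ω, Y ω)) ≤ entropy p Y + entropy p U := by
  have h := condEntropy_le_condEntropy_comp hp hp1 U Y (fun _ => ())
  rw [condEntropy_eq_entropy_sub hp, condEntropy_eq_entropy_sub hp] at h
  have h0 : entropy p (fun _ : Ω => ()) = 0 := by simp [entropy, prob_true, hp1]
  have h1 : entropy p (fun ω => (U ω, ())) = entropy p U :=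
    entropy_congr fun ω ω' => by simp
  linarith

/-- The covering lemma for blocks: `n I(Y;U)` bits suffice to describe a sequence that can replace
`Uⁿ` as far as events which are asymptotically rare for `(Wⁿ, Yⁿ, Uⁿ)` are concerned. -/
lemma IsMarkovChain.eventually_exists_quantizer (hp : ∀ ω, 0 ≤ p ω) (hp1 : ∑ ω, p ω = 1)
    {W : Ω → 𝒲} {Y : Ω → 𝒴} {U : Ω → 𝒰} (h : IsMarkovChain p W Y U)
    (B : ∀ n : ℕ, (Fin n → 𝒲) → (Fin n → 𝒴) → (Fin n → 𝒰) → Prop)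
    (hB : Tendsto (fun n : ℕ => prob (iidLaw p n)
      (fun ω => B n (block W n ω) (block Y n ω) (block U n ω))) atTop (𝓝 0))
    {I δ θ : ℝ} (hI : I = entropy p Y + entropy p U - entropy p (fun ω => (U ω, Y ω)))
    (hδ : 0 < δ) (hθ : 0 < θ) :
    ∀ᶠ n : ℕ in atTop, ∃ (M : ℕ) (c : Fin M → Fin n → 𝒰) (v : (Fin n → 𝒴) → Fin M),
      Real.logb 2 M ≤ n * (I + 3 * δ) ∧
      prob (iidLaw p n) (fun ω => B n (block W n ω) (block Y n ω) (c (v (block Y n ω)))) ≤ θ := by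
  have hI0 : 0 ≤ I := by rw [hI, sub_nonneg]; exact entropy_pair_le hp hp1 Y U
  have hexp : Tendsto (fun n : ℕ => Real.exp (-(2 : ℝ) ^ ((n : ℝ) * δ))) atTop (𝓝 0) :=
    Real.tendsto_exp_neg_atTop_nhds_zero.comp (tendsto_two_rpow_nat_mul hδ)
  have hn : ∀ᶠ n : ℕ in atTop, 1 ≤ n * δ :=
    (tendsto_natCast_atTop_atTop.atTop_mul_const hδ).eventually_ge_atTop 1
  filter_upwards [hB.eventually_le_const (show (0 : ℝ) < θ / 4 * (θ / 4) by positivity),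
    (tendsto_prob_density_gt hp hp1 Y U hI hδ).eventually_le_const (show 0 < θ / 4 by positivity),
    hexp.eventually_le_const (show 0 < θ / 4 by positivity), hn] with n h1 h2 h3 h4
  have hx : 0 ≤ n * (I + 2 * δ) := by positivity
  set M : ℕ := ⌈(2 : ℝ) ^ (n * (I + 2 * δ))⌉₊ with hM
  have hM0 : 0 < M := Nat.ceil_pos.2 (by positivity)
  set L : ℝ := (2 : ℝ) ^ (n * (I + δ)) with hL
  have hL0 : 0 < L := by positivity
  have hML : (2 : ℝ) ^ (n * δ) ≤ M / L := by
    rw [le_div_iff₀ hL0, hL, ← Real.rpow_add two_pos]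
    refine le_trans (le_of_eq ?_) (Nat.le_ceil _)
    congr 1
    ring
  obtain ⟨c, v, hcv⟩ := (h.iidLaw_block n).exists_quantizer (iidLaw_nonneg hp n) (sum_iidLaw hp1 n) (B n)
    hL0 (show 0 < θ / 4 by positivity) hM0
  refine ⟨M, c, v, ?_, hcv.trans ?_⟩
  · refine (logb_ceil_two_rpow_le hx).trans ?_
    linarith
  · have h5 := (div_le_iff₀ (show 0 < θ / 4 by positivity)).2 h1
    have h6 : Real.exp (-(M / L)) ≤ Real.exp (-(2 : ℝ) ^ ((n : ℝ) * δ)) :=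
      Real.exp_le_exp.2 (neg_le_neg hML)
    linarith

end Asymptotics

/-! ### The code -/

section Achievability

variable {Ω 𝒳 𝒴 𝒵 ℰ 𝒰 : Type*} [Fintype Ω] [Fintype 𝒳] [Fintype 𝒴] [Fintype 𝒵] [Fintype ℰ]
  [Fintype 𝒰] {p : Ω → ℝ}

/-- The numbers of bins in the two layers: out of `2 ^ (n R)` messages, `M₂ ≈ 2 ^ (n (h₂ + 3δ))`
go to the second layer and the quotient to the first one. -/
lemma exists_bin_numbers {h₁ h₂ δ R t : ℝ} {n : ℕ} (hh₂ : 0 ≤ h₂) (hh : h₂ ≤ h₁)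
    (hδ : 0 < δ) (hR : h₁ + 4 * δ ≤ R) (ht : t = (2 : ℝ) ^ ((n : ℝ) * δ)) (ht3 : 3 ≤ t) :
    ∃ M₁ M₂ : ℕ, 0 < M₁ ∧ 0 < M₂ ∧ M₁ * M₂ ≤ ⌊(2 : ℝ) ^ ((n : ℝ) * R)⌋₊ ∧
      Real.logb 2 M₂ ≤ n * (h₂ + 3 * δ) + 1 ∧
      (2 : ℝ) ^ (n * (h₁ + 2 * δ)) / (M₁ * M₂) + (2 : ℝ) ^ (n * (h₂ + 2 * δ)) / M₂ ≤ 2 / t := by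
  have ht0 : 0 < t := by linarith
  have hpow : ∀ (h : ℝ) (k : ℕ), (2 : ℝ) ^ (n * (h + k * δ)) = (2 : ℝ) ^ (n * h) * t ^ k := by
    intro h k
    rw [ht, ← Real.rpow_natCast, ← Real.rpow_mul two_pos.le, ← Real.rpow_add two_pos]
    congr 1
    ring
  have e2 := fun h => hpow h 2
  have e3 := fun h => hpow h 3
  have e4 := fun h => hpow h 4
  push_cast at e2 e3 e4
  set a : ℝ := (2 : ℝ) ^ (n * h₁) with ha
  set b : ℝ := (2 : ℝ) ^ (n * h₂) with hb
  have hb0 : 0 < b := by positivity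
  have ha1 : 1 ≤ a := Real.one_le_rpow one_le_two (by have := hh₂.trans hh; positivity)
  have hba : b ≤ a := Real.rpow_le_rpow_of_exponent_le one_le_two (by gcongr)
  set M : ℕ := ⌊(2 : ℝ) ^ ((n : ℝ) * R)⌋₊ with hM
  set M₂ : ℕ := ⌈(2 : ℝ) ^ (n * (h₂ + 3 * δ))⌉₊ with hM₂
  have hM_gt : a * t ^ 4 - 1 < M := by
    have h1 := Nat.sub_one_lt_floor ((2 : ℝ) ^ ((n : ℝ) * R))
    have h2 : (2 : ℝ) ^ (n * (h₁ + 4 * δ)) ≤ (2 : ℝ) ^ ((n : ℝ) * R) :=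
      Real.rpow_le_rpow_of_exponent_le one_le_two (by gcongr)
    rw [e4] at h2
    linarith
  have hM₂_lt : (M₂ : ℝ) < a * t ^ 3 + 1 := by
    have h1 := Nat.ceil_lt_add_one (a := (2 : ℝ) ^ (n * (h₂ + 3 * δ))) (by positivity)
    rw [e3] at h1
    have h2 : b * t ^ 3 ≤ a * t ^ 3 := by gcongr
    rw [hM₂, e3]
    linarith
  have hM₂_ge : b * t ^ 3 ≤ M₂ := by
    rw [← e3]
    exact Nat.le_ceil _
  have hM₂0 : 0 < M₂ := Nat.ceil_pos.2 (by positivity)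
  have hprod : a * t ^ 3 ≤ (M / M₂ : ℕ) * (M₂ : ℝ) := by
    have h1 : (M : ℝ) ≤ (M / M₂ : ℕ) * (M₂ : ℝ) + M₂ := by
      have := Nat.lt_div_mul_add (a := M) hM₂0
      exact_mod_cast this.le
    have h2 : 27 ≤ t ^ 3 := by
      calc (27 : ℝ) = 3 ^ 3 := by norm_num
        _ ≤ t ^ 3 := by gcongr
    have h3 : 27 ≤ a * t ^ 3 := by nlinarith
    nlinarith
  refine ⟨M / M₂, M₂, ?_, hM₂0, Nat.div_mul_le_self M M₂, ?_, ?_⟩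
  · by_contra h0
    have h0' : M / M₂ = 0 := Nat.eq_zero_of_not_pos h0
    rw [h0'] at hprod
    have : 0 < a * t ^ 3 := by positivity
    simp at hprod
    linarith
  · exact logb_ceil_two_rpow_le (by positivity)
  · rw [e2, e2]
    have h1 : a * t ^ 2 / ((M / M₂ : ℕ) * (M₂ : ℝ)) ≤ a * t ^ 2 / (a * t ^ 3) := by gcongr
    have h2 : b * t ^ 2 / M₂ ≤ b * t ^ 2 / (b * t ^ 3) := by gcongr
    have h3 : a * t ^ 2 / (a * t ^ 3) = 1 / t := by field_simp
    have h4 : b * t ^ 2 / (b * t ^ 3) = 1 / t := by field_simp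
    have h5 : 2 / t = 1 / t + 1 / t := by ring
    rw [h5]
    linarith

/-- The target rate `H(X|E,U) - H(Y|Z,U)` is achievable at every transmission rate above
`H(Y|Z)`. -/
lemma achievable_of_condEntropy_lt (hp : ∀ ω, 0 ≤ p ω) (hp1 : ∑ ω, p ω = 1)
    (X : Ω → 𝒳) (Y : Ω → 𝒴) (Z : Ω → 𝒵) (E : Ω → ℰ) (U : Ω → 𝒰)
    (hU : IsMarkovChain p (fun ω => (X ω, Z ω, E ω)) Y U) {R Δ : ℝ} (hΔ₀ : 0 ≤ Δ)
    (hR : condEntropy p Y Z < R)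
    (hΔ : Δ ≤ condEntropy p X (fun ω => (E ω, U ω)) - condEntropy p Y (fun ω => (Z ω, U ω))) :
    Achievable p X Y Z E R Δ := by
  classical
  refine ⟨(condEntropy_nonneg hp Y Z).trans hR.le, hΔ₀, fun ε hε => ?_⟩
  obtain ⟨ω₀⟩ : Nonempty Ω := by
    by_contra hne
    rw [not_nonempty_iff] at hne
    simp at hp1
  have : Nonempty 𝒴 := ⟨Y ω₀⟩
  have : Nonempty ℰ := ⟨E ω₀⟩
  set h₁ := condEntropy p Y Z with hh₁
  set h₂ := condEntropy p Y (fun ω => (Z ω, U ω)) with hh₂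
  set h₃ := condEntropy p Y (fun ω => ((X ω, E ω), U ω)) with hh₃
  set h₄ := condEntropy p E (fun ω => ((), U ω)) with hh₄
  have h₂0 : 0 ≤ h₂ := condEntropy_nonneg hp _ _
  have h₃0 : 0 ≤ h₃ := condEntropy_nonneg hp _ _
  have h₄0 : 0 ≤ h₄ := condEntropy_nonneg hp _ _
  have h₂₁ : h₂ ≤ h₁ := condEntropy_le_condEntropy_comp hp hp1 Y (fun ω => (Z ω, U ω)) Prod.fst
  obtain ⟨I, hI⟩ : ∃ I, I = entropy p Y + entropy p U - entropy p (fun ω => (U ω, Y ω)) := ⟨_, rfl⟩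
  -- the Markov property enters the equivocation through this identity
  have hident : entropy p (fun ω => ((X ω, E ω), Y ω)) - I - h₃ - h₄ =
      condEntropy p X (fun ω => (E ω, U ω)) := by
    have hm := (hU.comp_left (fun x => (x.1, x.2.2))).entropy_add hp
    rw [hI, hh₃, hh₄]
    simp only [condEntropy_eq_entropy_sub hp] at hm ⊢
    have e1 : entropy p (fun ω => (Y ω, (X ω, E ω), U ω)) =
        entropy p (fun ω => ((X ω, E ω), Y ω, U ω)) := entropy_congr fun ω ω' => by
      simp only [Prod.mk.injEq]; tauto
    have e2 : entropy p (fun ω => ((X ω, E ω), U ω)) =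
        entropy p (fun ω => (X ω, E ω, U ω)) := entropy_congr fun ω ω' => by
      simp only [Prod.mk.injEq]; tauto
    have e3 : entropy p (fun ω => (E ω, (), U ω)) =
        entropy p (fun ω => (E ω, U ω)) := entropy_congr fun ω ω' => by simp
    have e4 : entropy p (fun ω => ((), U ω)) = entropy p U := entropy_congr fun ω ω' => by simp
    have e5 : entropy p (fun ω => (U ω, Y ω)) = entropy p (fun ω => (Y ω, U ω)) :=
      entropy_congr fun ω ω' => by simp only [Prod.mk.injEq]; tauto
    linarith
  set δ : ℝ := min ((R - h₁) / 4) (ε / 12) with hδ'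
  have hδ : 0 < δ := lt_min (by linarith) (by linarith)
  have hδR : h₁ + 4 * δ ≤ R := by linarith [min_le_left ((R - h₁) / 4) (ε / 12)]
  have hδε : 12 * δ ≤ ε := by linarith [min_le_right ((R - h₁) / 4) (ε / 12)]
  obtain ⟨Q₁, C₁, -, hQ₁0, hQ₁1, -, hQ₁⟩ := exists_pos_kernel hp hp1 Y Z hδ
  obtain ⟨Q₂, C₂, -, hQ₂0, hQ₂1, -, hQ₂⟩ := exists_pos_kernel hp hp1 Y (fun ω => (Z ω, U ω)) hδ
  obtain ⟨Q₃, C₃, hC₃, hQ₃0, hQ₃1, hQ₃C, hQ₃⟩ :=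
    exists_pos_kernel hp hp1 Y (fun ω => ((X ω, E ω), U ω)) hδ
  obtain ⟨Q₄, C₄, hC₄, hQ₄0, hQ₄1, hQ₄C, hQ₄⟩ :=
    exists_pos_kernel hp hp1 E (fun ω => ((), U ω)) hδ
  set θ : ℝ := min (ε / 2) (δ / (C₃ + C₄ + 1)) with hθ'
  have hθ : 0 < θ := lt_min (by linarith) (by positivity)
  have hθε : θ ≤ ε / 2 := min_le_left _ _
  have hθC : (C₃ + C₄) * θ ≤ δ := by
    have h : θ ≤ δ / (C₃ + C₄ + 1) := min_le_right _ _
    rw [le_div_iff₀ (by positivity)] at h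
    nlinarith
  set W : Ω → 𝒳 × 𝒵 × ℰ := fun ω => (X ω, Z ω, E ω) with hW
  -- the atypical event: one of the four codelengths is too long
  set B : ∀ n : ℕ, (Fin n → 𝒳 × 𝒵 × ℰ) → (Fin n → 𝒴) → (Fin n → 𝒰) → Prop := fun n w y u =>
    n * (h₁ + 2 * δ) < ∑ i, -Real.logb 2 (Q₁ (y i) (w i).2.1) ∨
    n * (h₂ + 2 * δ) < ∑ i, -Real.logb 2 (Q₂ (y i) ((w i).2.1, u i)) ∨
    n * (h₃ + 2 * δ) < ∑ i, -Real.logb 2 (Q₃ (y i) (((w i).1, (w i).2.2), u i)) ∨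
    n * (h₄ + 2 * δ) < ∑ i, -Real.logb 2 (Q₄ (w i).2.2 ((), u i)) with hBdef
  have hB : Tendsto (fun n : ℕ => prob (iidLaw p n)
      (fun ω => B n (block W n ω) (block Y n ω) (block U n ω))) atTop (𝓝 0) := by
    have t₁ := tendsto_prob_lt_sum hp hp1 (fun ω => -Real.logb 2 (Q₁ (Y ω) (Z ω)))
      (a := h₁ + 2 * δ) hδ (by linarith)
    have t₂ := tendsto_prob_lt_sum hp hp1 (fun ω => -Real.logb 2 (Q₂ (Y ω) (Z ω, U ω)))
      (a := h₂ + 2 * δ) hδ (by linarith)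
    have t₃ := tendsto_prob_lt_sum hp hp1 (fun ω => -Real.logb 2 (Q₃ (Y ω) ((X ω, E ω), U ω)))
      (a := h₃ + 2 * δ) hδ (by linarith)
    have t₄ := tendsto_prob_lt_sum hp hp1 (fun ω => -Real.logb 2 (Q₄ (E ω) ((), U ω)))
      (a := h₄ + 2 * δ) hδ (by linarith)
    have t := t₁.add (t₂.add (t₃.add t₄))
    simp only [add_zero] at t
    refine squeeze_zero (fun n => prob_nonneg (iidLaw_nonneg hp n) _) (fun n => ?_) t
    have hp' := iidLaw_nonneg hp n
    exact (prob_or_le hp' _ _).trans (add_le_add_right ((prob_or_le hp' _ _).trans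
      (add_le_add_right (prob_or_le hp' _ _) _)) _)
  have hnδ : ∀ᶠ n : ℕ in atTop, 1 ≤ n * δ :=
    (tendsto_natCast_atTop_atTop.atTop_mul_const hδ).eventually_ge_atTop 1
  filter_upwards [hU.eventually_exists_quantizer hp hp1 B hB hI hδ hθ, hnδ,
    (tendsto_two_rpow_nat_mul hδ).eventually_ge_atTop 3,
    (tendsto_two_rpow_nat_mul hδ).eventually_gt_atTop (4 / ε)] with n hquant hn ht3 htε
  obtain ⟨M₀, c, v, hM₀, hbad⟩ := hquant
  have hp' := iidLaw_nonneg hp n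
  have hp1' := sum_iidLaw hp1 n
  have hn0 : (0 : ℝ) < n := by
    by_contra h0
    have : (n : ℝ) = 0 := le_antisymm (not_lt.1 h0) (Nat.cast_nonneg n)
    rw [this] at hn
    linarith
  obtain ⟨M₁, M₂, hM₁0, hM₂0, hM₁₂, hM₂, hN⟩ :=
    exists_bin_numbers h₂0 h₂₁ hδ hδR rfl ht3
  set T : (Fin n → 𝒵) → (Fin n → 𝒴) → Prop := fun z y =>
    ∑ i, -Real.logb 2 (Q₁ (y i) (z i)) ≤ n * (h₁ + 2 * δ) ∧
    ∑ i, -Real.logb 2 (Q₂ (y i) (z i, c (v y) i)) ≤ n * (h₂ + 2 * δ) with hT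
  obtain ⟨e₁, e₂, d, hd⟩ := exists_binning hp' hp1' (block Y n) (block Z n) v T
    (N₁ := (2 : ℝ) ^ (n * (h₁ + 2 * δ))) (N₂ := (2 : ℝ) ^ (n * (h₂ + 2 * δ)))
    (fun z => card_codelength_le hQ₁0 hQ₁1 z _ _ fun y hy => (Finset.mem_filter.1 hy).2.1)
    (fun z v₀ => card_codelength_le hQ₂0 hQ₂1 (fun i => (z i, c v₀ i)) _ _ fun y hy => by
      obtain ⟨-, hTy, rfl⟩ := Finset.mem_filter.1 hy
      exact hTy.2) hM₁0 hM₂0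
  set ι : Fin M₁ × Fin M₂ → Fin ⌊(2 : ℝ) ^ ((n : ℝ) * R)⌋₊ :=
    fun x => Fin.castLE hM₁₂ (finProdFinEquiv x) with hι
  have hι_inj : Function.Injective ι :=
    (Fin.castLE_injective hM₁₂).comp finProdFinEquiv.injective
  have : Nonempty (Fin M₁ × Fin M₂) := ⟨(⟨0, hM₁0⟩, ⟨0, hM₂0⟩)⟩
  refine ⟨⟨fun y => ι (e₁ (v y), e₂ y), fun m z => d (Function.invFun ι m) z⟩, ?_, ?_⟩
  · simp only [Code.errorProb, Code.message, Function.leftInverse_invFun hι_inj _]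
    refine hd.trans_lt ?_
    have h1 : prob (iidLaw p n) (fun ω => ¬ T (block Z n ω) (block Y n ω)) ≤ θ := by
      refine le_trans (prob_mono hp' fun ω hω => ?_) hbad
      rw [hT, not_and_or, not_le, not_le] at hω
      rcases hω with hω | hω
      · exact Or.inl hω
      · exact Or.inr (Or.inl hω)
    have h2 : 2 / (2 : ℝ) ^ ((n : ℝ) * δ) < ε / 2 := by
      rw [div_lt_iff₀ hε] at htε
      rw [div_lt_iff₀ (by positivity)]
      linarith
    linarith
  · have hmsg := le_condEntropy_of_message hp' hp1' (block X n) (block Y n) (block E n) v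
      (fun ω => e₂ (block Y n ω)) (fun x => ι (e₁ x.1, x.2))
    have hYXE := condEntropy_le_of_prob_codelength_le hp' hp1' hQ₃0 hQ₃1 hC₃ hQ₃C (block Y n)
      (fun ω => (block X n ω, block E n ω)) (fun x i => (x.1 i, x.2 i)) (fun ω => v (block Y n ω)) c
      (s := n * (h₃ + 2 * δ)) (θ := θ) (by positivity)
      (le_trans (prob_mono hp' fun ω hω => Or.inr (Or.inr (Or.inl hω))) hbad)
    have hE := condEntropy_le_of_prob_codelength_le hp' hp1' hQ₄0 hQ₄1 hC₄ hQ₄C (block E n)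
      (fun _ => ()) (fun _ _ => ()) (fun ω => v (block Y n ω)) c
      (s := n * (h₄ + 2 * δ)) (θ := θ) (by positivity)
      (le_trans (prob_mono hp' fun ω hω => Or.inr (Or.inr (Or.inr hω))) hbad)
    have hXEY : entropy (iidLaw p n) (fun ω => ((block X n ω, block E n ω), block Y n ω)) =
        n * entropy p (fun ω => ((X ω, E ω), Y ω)) := by
      rw [← entropy_block hp hp1]
      refine entropy_congr fun ω ω' => ?_
      simp only [Prod.mk.injEq, funext_iff, block, ← forall_and]
    rw [hXEY, Fintype.card_fin, Fintype.card_fin] at hmsg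
    simp only [Code.equivocation, Code.message]
    rw [one_div, ← div_eq_inv_mul, le_div_iff₀ hn0]
    refine le_trans ?_ hmsg
    have h1 : n * Δ ≤ n * (entropy p (fun ω => ((X ω, E ω), Y ω)) - I - h₃ - h₄ - h₂) :=
      mul_le_mul_of_nonneg_left (by rw [hident]; exact hΔ) hn0.le
    have h2 : n * ((C₃ + C₄) * θ) ≤ n * δ := mul_le_mul_of_nonneg_left hθC hn0.le
    have h3 : n * (12 * δ) ≤ n * ε := mul_le_mul_of_nonneg_left hδε hn0.le
    linarith

end Achievability

end SecureCoding

theorem theorem3 {Ω 𝒳 𝒴 𝒵 ℰ 𝒰 : Type*}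
    [Fintype Ω] [Fintype 𝒳] [Fintype 𝒴] [Fintype 𝒵] [Fintype ℰ] [Fintype 𝒰]
    (p : Ω → ℝ) (hp : p ∈ stdSimplex ℝ Ω)
    (X : Ω → 𝒳) (Y : Ω → 𝒴) (Z : Ω → 𝒵) (E : Ω → ℰ) (U : Ω → 𝒰)
    (hU : SecureCoding.IsMarkovChain p (fun ω => (X ω, Z ω, E ω)) Y U)
    (R Δ : ℝ) (hΔ₀ : 0 ≤ Δ)
    (hR : SecureCoding.condEntropy p Y Z ≤ R)
    (hΔ : Δ ≤ SecureCoding.condMutualInfo p Y Z U - SecureCoding.condMutualInfo p Y E U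
      + SecureCoding.condEntropy p X (fun ω => (E ω, U ω))
      - SecureCoding.condEntropy p Y (fun ω => (E ω, U ω))) :
    (SecureCoding.condEntropy p Y Z < R → SecureCoding.Achievable p X Y Z E R Δ) ∧
      (R, Δ) ∈ closure {q : ℝ × ℝ | SecureCoding.Achievable p X Y Z E q.1 q.2} := by
  have hΔ' : Δ ≤ SecureCoding.condEntropy p X (fun ω => (E ω, U ω)) -
      SecureCoding.condEntropy p Y (fun ω => (Z ω, U ω)) := by
    simp only [SecureCoding.condMutualInfo] at hΔ
    linarith
  have key : ∀ R' : ℝ, SecureCoding.condEntropy p Y Z < R' →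
      SecureCoding.Achievable p X Y Z E R' Δ := fun R' hR' =>
    SecureCoding.achievable_of_condEntropy_lt hp.1 hp.2 X Y Z E U hU hΔ₀ hR' hΔ'
  refine ⟨key R, ?_⟩
  have hlim : Tendsto (fun k : ℕ => (R + 1 / ((k : ℝ) + 1), Δ)) atTop (𝓝 (R, Δ)) := by
    have h := tendsto_one_div_add_atTop_nhds_zero_nat (𝕜 := ℝ)
    have h' := (tendsto_const_nhds (x := R)).add h
    rw [add_zero] at h'
    exact h'.prodMk_nhds tendsto_const_nhds
  refine mem_closure_of_tendsto hlim (Eventually.of_forall fun k => key _ ?_)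
  have : (0 : ℝ) < 1 / ((k : ℝ) + 1) := by positivity
  linarith
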